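/- **Setting.** For every $n$ let the full data consist of covariate vectors $\mathbf z_i=(z_{i1},\dots,z_{ip})^{\rm T}$ and responses $y_i=\beta_0+\sum_{j=1}^p z_{ij}\beta_j+\varepsilon_i$, $i=1,\dots,n$. The rows $\mathbf z_1,\dots,\mathbf z_n$ are independent, and the $j$th component of each has the distribution function $F_j$, which does not depend on $n$. Given the covariate matrix $\mathbf Z$, the errors have mean $0$, are uncorrelated and have variance $\sigma^2>0$. Here $p=p_n\ge 1$ and $r=r_n$ may depend on $n$; put $k=2pr$ and suppose that $r\ge1$ and $k\le n$ for all large $n$. Let $z_{(1)j}\le\dots\le z_{(n)j}$ be the order statistics of $z_{1j},\dots,z_{nj}$ and $F_j^{-1}(q)=\inf\{x: F_j(x)\ge q\}$. The IBOSS subdata of size $k$ are obtained as follows: for $j=1,\dots,p$ in turn, among the data points not selected before, select $r$ points with the smallest and $r$ other points with the largest values of $z_{ij}$ (ties are broken by any measurable rule depending on $\mathbf Z$ only). Let $\hat{\boldsymbol\beta}^{\mathrm D}=(\hat\beta_0^{\mathrm D},\dots,\hat\beta_p^{\mathrm D})^{\rm T}$ be the least-squares estimator (with intercept) computed from the subdata,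 $\mathrm V(\hat\beta_j^{\mathrm D}|\mathbf Z)$ the conditional variance of $\hat\beta_j^{\mathrm D}$ given $\mathbf Z$, and $\mathbf R$ the sample correlation matrix of the covariates in the subdata, with smallest eigenvalue $\lambda_{\min}(\mathbf R)$. For nonnegative random sequences, possibly with value $\infty$, $A_n=O_P(B_n)$ means that for every $\delta>0$ there is $M<\infty$ with $P(A_n>MB_n)\le\delta$ for all large $n$, and $A_n\asymp_P B_n$ means $A_n=O_P(B_n)$ and $B_n=O_P(A_n)$; $p/(k\cdot 0)$ is read as $\infty$. **Theorem.** Assume that every covariate distribution is in the domain of attraction of the generalized extreme value distribution in both tails (that is, there are a generalized extreme value distribution function $G$ and constants $a_n>0$, $b_n$ with $F(a_nx+b_n)^n\to G(x)$ for all $x$, both for $F=F_j$ and for $F$ the distribution function of $-z_{1j}$), and that $\liminf_{n\to\infty}\lambda_{\min}(\mathbf R)>0$ almost surely. Then $$\mathrm V(\hat\beta^{\mathrm D}_j|\mathbf Z)=O_P\left\{\frac{p}{k(z_{(n-r+1)j}-z_{(r)j})^2}\right\},\qquad j=1,\dots,p,$$ also when $p$ depends on $n$, and then for every sequence $j=j_n\in\{1,\dots,p_n\}$.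 Furthermore, if $p$ is fixed (or just bounded in $n$), then for every fixed $j$ that is at most $p_n$ for all $n$, $$\mathrm V(\hat\beta^{\mathrm D}_j|\mathbf Z)\asymp_P\frac{p}{k(z_{(n)j}-z_{(1)j})^2},$$ if one of the following conditions holds: 1. $r$ is fixed (constant for all large $n$); 2. the support of $F_j$ is bounded, $r\to\infty$ and $r/n\to0$; 3. the upper endpoint of the support of $F_j$ is $\infty$, the lower endpoint is finite, $r\to\infty$, and for all $\epsilon>0$ $$\frac{r}{n[1-F_j\{(1-\epsilon)F_j^{-1}(1-n^{-1})\}]}\to0;\qquad(\mathrm a)$$ 4. the upper endpoint of the support of $F_j$ is finite, the lower endpoint is $-\infty$, $r\to\infty$, and for all $\epsilon>0$ $$\frac{r}{nF_j\{(1-\epsilon)F_j^{-1}(n^{-1})\}}\to0;\qquad(\mathrm b)$$ 5. the upper and lower endpoints of the support of $F_j$ are $\infty$ and $-\infty$, respectively, and (a) and (b) hold. -/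

import Mathlib

open MeasureTheory ProbabilityTheory Filter Topology
open scoped ENNReal

noncomputable section

/-! ### Linear regression on subdata -/

/-- The design matrix `(1, z)`: a column of ones followed by the covariates. -/
def designMatrix {m : Type*} {p : ℕ} (z : m → Fin p → ℝ) : Matrix m (Fin (p + 1)) ℝ :=
  Matrix.of fun i => Fin.cons 1 (z i)

/-- The least-squares estimator `(Xᵀ X)⁻¹ Xᵀ y`. -/
def olsEstimator {m q : Type*} [Fintype m] [Fintype q] [DecidableEq q]
    (X : Matrix m q ℝ) (y : m → ℝ) : q → ℝ :=
  (X.transpose * X)⁻¹.mulVec (X.transpose.mulVec y)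

/-- Restriction of row-indexed data to the rows in `S`. -/
def restrictRows {n : ℕ} {α : Type*} (S : Finset (Fin n)) (z : Fin n → α) : S → α :=
  fun i => z i

/-! ### Sample correlation matrix and its smallest eigenvalue -/

/-- Sample mean of the `j`-th column. -/
def sampleMean {m : Type*} [Fintype m] {p : ℕ} (z : m → Fin p → ℝ) (j : Fin p) : ℝ :=
  (∑ i, z i j) / (Fintype.card m : ℝ)

/-- Sample covariance of the columns `j` and `l`. -/
def sampleCov {m : Type*} [Fintype m] {p : ℕ} (z : m → Fin p → ℝ) (j l : Fin p) : ℝ :=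
  (∑ i, (z i j - sampleMean z j) * (z i l - sampleMean z l)) / ((Fintype.card m : ℝ) - 1)

/-- Sample correlation matrix. A column without variation gets a zero row and a zero column,
so that the matrix is then singular. -/
def sampleCorr {m : Type*} [Fintype m] {p : ℕ} (z : m → Fin p → ℝ) :
    Matrix (Fin p) (Fin p) ℝ :=
  Matrix.of fun j l => sampleCov z j l / (√(sampleCov z j j) * √(sampleCov z l l))

/-- The smallest (real) eigenvalue of a square matrix. -/
def lambdaMin {p : ℕ} (A : Matrix (Fin p) (Fin p) ℝ) : ℝ :=
  sInf (spectrum ℝ A)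

/-! ### The selection algorithm -/

/-- The rows that are still available before covariate `j` is processed, when the rows
`L l ∪ U l` have been selected for every `l < j`. -/
def remainingRows {n p : ℕ} (L U : Fin p → Finset (Fin n)) (j : Fin p) : Finset (Fin n) :=
  Finset.univ \ (Finset.univ.filter (fun l : Fin p => l < j)).biUnion (fun l => L l ∪ U l)

/-- `S` is a possible output of the D-optimality motivated algorithm with parameter `r`, run on
the covariates `z`: the covariates are processed in order, and for the `j`-th one `r` rows `L j`
with the smallest and `r` other rows `U j` with the largest values of that covariate are selected
among the rows not selected before. Ties may be broken in any way. -/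
def IsIBOSSSubset {n p : ℕ} (r : ℕ) (z : Fin n → Fin p → ℝ) (S : Finset (Fin n)) : Prop :=
  ∃ L U : Fin p → Finset (Fin n),
    (∀ j,
      L j ⊆ remainingRows L U j ∧ U j ⊆ remainingRows L U j ∧ Disjoint (L j) (U j) ∧
      (L j).card = r ∧ (U j).card = r ∧
      (∀ i ∈ L j, ∀ i' ∈ remainingRows L U j \ L j, z i j ≤ z i' j) ∧
      (∀ i ∈ U j, ∀ i' ∈ remainingRows L U j \ U j, z i' j ≤ z i j)) ∧
    S = Finset.univ.biUnion (fun j => L j ∪ U j)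

/-- The least-squares estimator (intercept at index `0`, `j`-th slope at index `j.succ`)
computed from the rows in `S`. -/
def subdataEstimator {n p : ℕ} (S : Finset (Fin n)) (z : Fin n → Fin p → ℝ) (y : Fin n → ℝ) :
    Fin (p + 1) → ℝ :=
  olsEstimator (designMatrix (restrictRows S z)) (restrictRows S y)

/-- The `m`-th order statistic (`1 ≤ m ≤ n`) of `x`: the least `t` such that at least `m` of the
values are `≤ t`. -/
def orderStat {n : ℕ} (x : Fin n → ℝ) (m : ℕ) : ℝ :=
  sInf {t : ℝ | m ≤ (Finset.univ.filter (fun i => x i ≤ t)).card}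

/-! ### Probabilistic notions -/

/-- The conditional variance of `T` given `Z`: the variance of the regular conditional
distribution of `T` given `Z`. -/
def condVarGiven {Ω E : Type*} [MeasurableSpace Ω] [MeasurableSpace E] (μ : Measure Ω)
    [IsFiniteMeasure μ] (T : Ω → ℝ) (Z : Ω → E) (ω : Ω) : ℝ≥0∞ :=
  evariance (fun t : ℝ => t) (condDistrib T Z μ (Z ω))

/-- `A n = O_P(B n)`, for sequences of random elements of `[0, ∞]`. -/
def IsBigOP {Ω : Type*} [MeasurableSpace Ω] (μ : Measure Ω) (A B : ℕ → Ω → ℝ≥0∞) : Prop :=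
  ∀ δ : ℝ, 0 < δ → ∃ M : ℝ, 0 < M ∧
    ∀ᶠ n in atTop, μ {ω | ENNReal.ofReal M * B n ω < A n ω} ≤ ENNReal.ofReal δ

/-- `A n ≍_P B n`: both `A n = O_P(B n)` and `B n = O_P(A n)`. -/
def IsSameOrderP {Ω : Type*} [MeasurableSpace Ω] (μ : Measure Ω) (A B : ℕ → Ω → ℝ≥0∞) : Prop :=
  IsBigOP μ A B ∧ IsBigOP μ B A

/-- The rate `p / (k d²)` with `k = 2 p r`; it is `∞` when `d = 0`. -/
def rateOf (p r : ℕ) (d : ℝ) : ℝ≥0∞ :=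
  (p : ℝ≥0∞) / (((2 * p * r : ℕ) : ℝ≥0∞) * ENNReal.ofReal (d ^ 2))

/-! ### Extreme value theory and quantiles -/

/-- The standard generalized extreme value distribution function with shape `ξ`. -/
def gevCDF (ξ x : ℝ) : ℝ :=
  if ξ = 0 then Real.exp (-Real.exp (-x))
  else if 0 < 1 + ξ * x then Real.exp (-(1 + ξ * x) ^ (-1 / ξ))
  else if 0 < ξ then 0 else 1

/-- Suitably normalized maxima of i.i.d. variables with law `ν` converge in distribution to a
generalized extreme value law. -/
def InMaxDomain (ν : Measure ℝ) : Prop :=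
  ∃ (ξ : ℝ) (a b : ℕ → ℝ), (∀ n, 0 < a n) ∧
    ∀ x : ℝ, Tendsto (fun n : ℕ => cdf ν (a n * x + b n) ^ n) atTop (𝓝 (gevCDF ξ x))

/-- Both the maxima and (after a change of sign) the minima are attracted. -/
def InGEVDomain (ν : Measure ℝ) : Prop :=
  InMaxDomain ν ∧ InMaxDomain (ν.map fun x => -x)

/-- The quantile function `F⁻¹(q) = inf {x | q ≤ F x}`. -/
def quantile (ν : Measure ℝ) (q : ℝ) : ℝ :=
  sInf {x : ℝ | q ≤ cdf ν x}

/-- Upper endpoint of the support. -/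
def upperEndpoint (ν : Measure ℝ) : EReal :=
  sSup ((fun x : ℝ => (x : EReal)) '' {x : ℝ | cdf ν x < 1})

/-- Lower endpoint of the support. -/
def lowerEndpoint (ν : Measure ℝ) : EReal :=
  sInf ((fun x : ℝ => (x : EReal)) '' {x : ℝ | 0 < cdf ν x})

/-- `r / (n [1 - F{(1-ε) F⁻¹(1 - 1/n)}]) → 0` for all `ε > 0`. -/
def UpperTailCondition (ν : Measure ℝ) (r : ℕ → ℕ) : Prop :=
  ∀ ε : ℝ, 0 < ε → Tendsto
    (fun n : ℕ => (r n : ℝ) /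
      ((n : ℝ) * (1 - cdf ν ((1 - ε) * quantile ν (1 - (n : ℝ)⁻¹))))) atTop (𝓝 0)

/-- `r / (n F{(1-ε) F⁻¹(1/n)}) → 0` for all `ε > 0`. -/
def LowerTailCondition (ν : Measure ℝ) (r : ℕ → ℕ) : Prop :=
  ∀ ε : ℝ, 0 < ε → Tendsto
    (fun n : ℕ => (r n : ℝ) /
      ((n : ℝ) * cdf ν ((1 - ε) * quantile ν ((n : ℝ)⁻¹)))) atTop (𝓝 0)

/-- The five alternative conditions on the number `r` of extreme rows taken per tail and on the
law `ν` of a covariate. -/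
def RangeCondition (ν : Measure ℝ) (r : ℕ → ℕ) : Prop :=
  (∃ r₀ : ℕ, ∀ᶠ n in atTop, r n = r₀) ∨
  (upperEndpoint ν ≠ ⊤ ∧ lowerEndpoint ν ≠ ⊥ ∧ Tendsto r atTop atTop ∧
    Tendsto (fun n : ℕ => (r n : ℝ) / (n : ℝ)) atTop (𝓝 0)) ∨
  (upperEndpoint ν = ⊤ ∧ lowerEndpoint ν ≠ ⊥ ∧ Tendsto r atTop atTop ∧
    UpperTailCondition ν r) ∨
  (upperEndpoint ν ≠ ⊤ ∧ lowerEndpoint ν = ⊥ ∧ Tendsto r atTop atTop ∧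
    LowerTailCondition ν r) ∨
  (upperEndpoint ν = ⊤ ∧ lowerEndpoint ν = ⊥ ∧
    UpperTailCondition ν r ∧ LowerTailCondition ν r)

end

/-!
Given the covariates, the variance of the `j`-th slope is `σ² [(Xᵀ X)⁻¹]_jj`, where `X` is the
selected design matrix (`condVarGiven_subdataEstimator`). If `s²` denotes the sum of squares of the
`j`-th selected covariate about its mean and `λ_min(R) ≥ c > 0`, then this entry lies between
`1 / s²` and `1 / (c s²)` (`inv_centredSS_le_inv_gram`, `CorrBoundedBelow.inv_gram_le`).
The assumption on `λ_min(R)` provides such a `c` for all large `n`, on events of probability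
close to one (`exists_uniform_bound`).

It remains to compare `s²` with order statistics. Whatever was selected for the earlier covariates,
the subdata contain at least `m` values not above the `m`-th smallest value of the full data, and
at least `m` values not below the `m`-th largest one, for every `m ≤ r`
(`IsIBOSSSubset.le_card_le`, `IsIBOSSSubset.le_card_ge`). One of these groups is far from the
mean, so `s²` is at least `m / 4` times the squared distance of the two order statistics. With
`m = r` this is the general upper bound. On the other hand `s²` is at most `k` times the squared
range, which is the lower bound for bounded `p`.

For the upper bound in terms of the range, the case of constant `r` follows with `m = 1`.
In the remaining cases the range and `z_(n-r+1) - z_(r)` are of the same order in probability,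
which is shown for each tail separately. A bounded tail only needs `r / n → 0` and a nondegenerate
law. For an unbounded one, with quantiles `Q n` at level `1 - 1 / n`, the tail condition says that
the expected number of observations beyond `Q n / 2` is large compared with `r`, so that at least
`r` of them lie there by Chebyshev's inequality. The same condition, used at a larger index, makes
the tail decay so fast that no observation exceeds `4 * Q n` (`tendsto_mul_tail`). Of the
domain of attraction assumption only the nondegeneracy of the law enters.
-/

/-! ### Linear algebra of the least-squares estimator -/

lemma designMatrix_mulVec {m : Type*} {p : ℕ} (z : m → Fin p → ℝ) (x : Fin (p + 1) → ℝ) (i : m) :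
    (designMatrix z).mulVec x i = x 0 + ∑ l, z i l * x l.succ := by
  simp [designMatrix, Matrix.mulVec, dotProduct, Fin.sum_univ_succ]

/-- The sum of squares of the `j`-th column about its sample mean. -/
noncomputable def centredSS {m : Type*} [Fintype m] {p : ℕ} (z : m → Fin p → ℝ) (j : Fin p) : ℝ :=
  ∑ i, (z i j - sampleMean z j) ^ 2

/-- The Gram matrix `Xᵀ X` of the design matrix with intercept. -/
def gramMatrix {m : Type*} [Fintype m] {p : ℕ} (z : m → Fin p → ℝ) :
    Matrix (Fin (p + 1)) (Fin (p + 1)) ℝ :=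
  (designMatrix z).transpose * designMatrix z

/-- The quadratic form of the sample correlation matrix is bounded below by `c`. This replaces
`c ≤ λ_min(R)`: it is what the estimates use, and it is visibly measurable in the data. -/
def CorrBoundedBelow {m : Type*} [Fintype m] {p : ℕ} (c : ℝ) (z : m → Fin p → ℝ) : Prop :=
  ∀ x : Fin p → ℝ, c * ∑ l, x l ^ 2 ≤ ∑ l, ∑ q, x l * sampleCorr z l q * x q

section Gram

variable {m : Type*} [Fintype m] {p : ℕ} (z : m → Fin p → ℝ)

lemma sum_sub_sampleMean (j : Fin p) : ∑ i, (z i j - sampleMean z j) = 0 := by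
  rcases isEmpty_or_nonempty m with h | h
  · simp
  · have : (Fintype.card m : ℝ) ≠ 0 := by simp
    simp only [Finset.sum_sub_distrib, Finset.sum_const, Finset.card_univ, nsmul_eq_mul, sampleMean]
    field_simp
    simp

lemma sampleCov_self (j : Fin p) :
    sampleCov z j j = centredSS z j / ((Fintype.card m : ℝ) - 1) := by
  simp [sampleCov, centredSS, sq]

lemma centredSS_nonneg (j : Fin p) : 0 ≤ centredSS z j :=
  Finset.sum_nonneg fun _ _ => sq_nonneg _

lemma dotProduct_gramMatrix_mulVec (x y : Fin (p + 1) → ℝ) :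
    x ⬝ᵥ (gramMatrix z).mulVec y
      = ∑ i, (designMatrix z).mulVec x i * (designMatrix z).mulVec y i := by
  rw [gramMatrix, ← Matrix.mulVec_mulVec, Matrix.dotProduct_mulVec, Matrix.vecMul_transpose]
  rfl

variable {z} {c : ℝ}

lemma CorrBoundedBelow.sampleCov_pos (hc : 0 < c) (h : CorrBoundedBelow c z) (j : Fin p) :
    0 < sampleCov z j j ∧ 1 < (Fintype.card m : ℝ) := by
  classical
  have hj := h (Pi.single j 1)
  have h1 : ∑ l, (Pi.single j 1 : Fin p → ℝ) l ^ 2 = 1 := by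
    rw [Finset.sum_eq_single j] <;> simp +contextual
  have h2 : ∑ l, ∑ q, (Pi.single j 1 : Fin p → ℝ) l * sampleCorr z l q
      * (Pi.single j 1 : Fin p → ℝ) q = sampleCorr z j j := by
    rw [Finset.sum_eq_single j, Finset.sum_eq_single j] <;>
      simp +contextual [Pi.single_apply]
  rw [h1, h2, mul_one] at hj
  have h3 : sampleCov z j j ≠ 0 := by
    intro h0
    simp [sampleCorr, h0] at hj
    linarith
  -- a matrix entry `x / (√x * √x)` of a negative `x` vanishes, so the variance is positive
  have h4 : 0 < sampleCov z j j := by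
    by_contra hneg
    have : √(sampleCov z j j) = 0 := Real.sqrt_eq_zero_of_nonpos (not_lt.1 hneg)
    simp [sampleCorr, this] at hj
    linarith
  refine ⟨h4, ?_⟩
  rw [sampleCov_self] at h4
  by_contra hle
  have := div_nonpos_of_nonneg_of_nonpos (centredSS_nonneg z j)
    (show (Fintype.card m : ℝ) - 1 ≤ 0 by linarith)
  linarith

lemma CorrBoundedBelow.centredSS_pos (hc : 0 < c) (h : CorrBoundedBelow c z) (j : Fin p) :
    0 < centredSS z j := by
  obtain ⟨h1, h2⟩ := h.sampleCov_pos hc j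
  rw [sampleCov_self] at h1
  have h3 : (0 : ℝ) < (Fintype.card m : ℝ) - 1 := by linarith
  exact (div_pos_iff_of_pos_right h3).1 h1

/-- The bound on the correlation matrix, applied to the standardized coefficients. -/
lemma CorrBoundedBelow.sum_centredSS_le (hc : 0 < c) (h : CorrBoundedBelow c z) (x : Fin p → ℝ) :
    c * ∑ l, centredSS z l * x l ^ 2 ≤ ∑ i, (∑ l, (z i l - sampleMean z l) * x l) ^ 2 := by
  rcases isEmpty_or_nonempty (Fin p) with hp | ⟨⟨j⟩⟩
  · simp
  set N : ℝ := (Fintype.card m : ℝ) - 1 with hN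
  have hN0 : 0 < N := by
    have := (h.sampleCov_pos hc j).2
    linarith
  have key := h fun l => √(sampleCov z l l) * x l
  have hl : ∑ l, (√(sampleCov z l l) * x l) ^ 2 = (∑ l, centredSS z l * x l ^ 2) / N := by
    rw [Finset.sum_div]
    refine Finset.sum_congr rfl fun l _ => ?_
    rw [mul_pow, Real.sq_sqrt (h.sampleCov_pos hc l).1.le, sampleCov_self]
    ring
  have hr : ∑ l, ∑ q, √(sampleCov z l l) * x l * sampleCorr z l q * (√(sampleCov z q q) * x q)
      = (∑ i, (∑ l, (z i l - sampleMean z l) * x l) ^ 2) / N := by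
    have : ∀ l q, √(sampleCov z l l) * x l * sampleCorr z l q * (√(sampleCov z q q) * x q)
        = (∑ i, ((z i l - sampleMean z l) * x l) * ((z i q - sampleMean z q) * x q)) / N := by
      intro l q
      have e1 := (Real.sqrt_pos.2 (h.sampleCov_pos hc l).1).ne'
      have e2 := (Real.sqrt_pos.2 (h.sampleCov_pos hc q).1).ne'
      have : ∑ i, ((z i l - sampleMean z l) * x l) * ((z i q - sampleMean z q) * x q)
          = (∑ i, (z i l - sampleMean z l) * (z i q - sampleMean z q)) * (x l * x q) := by
        rw [Finset.sum_mul]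
        exact Finset.sum_congr rfl fun i _ => by ring
      rw [this]
      simp only [sampleCorr, Matrix.of_apply]
      have : sampleCov z l q = (∑ i, (z i l - sampleMean z l) * (z i q - sampleMean z q)) / N := rfl
      rw [this]
      field_simp
    simp_rw [this, ← Finset.sum_div]
    congr 1
    simp_rw [sq, Finset.sum_mul_sum]
    rw [Finset.sum_comm (s := (Finset.univ : Finset m))]
    exact Finset.sum_congr rfl fun l _ => Finset.sum_comm
  rw [hl, hr, mul_div_assoc', div_le_div_iff_of_pos_right hN0] at key
  exact key

lemma CorrBoundedBelow.sum_centredSS_le_gram (hc : 0 < c) (h : CorrBoundedBelow c z)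
    (x : Fin (p + 1) → ℝ) :
    c * ∑ l : Fin p, centredSS z l * x l.succ ^ 2 ≤ x ⬝ᵥ (gramMatrix z).mulVec x := by
  refine (h.sum_centredSS_le hc fun l => x l.succ).trans ?_
  rw [dotProduct_gramMatrix_mulVec]
  set w : m → ℝ := fun i => ∑ l, (z i l - sampleMean z l) * x l.succ with hw
  set t : ℝ := x 0 + ∑ l, sampleMean z l * x l.succ with ht
  have h0 : ∑ i, w i = 0 := by
    rw [hw, Finset.sum_comm]
    refine Finset.sum_eq_zero fun l _ => ?_
    rw [← Finset.sum_mul, sum_sub_sampleMean, zero_mul]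
  have h1 : ∀ i, (designMatrix z).mulVec x i = t + w i := by
    intro i
    rw [designMatrix_mulVec, ht, hw, add_assoc, ← Finset.sum_add_distrib]
    congr 1
    exact Finset.sum_congr rfl fun l _ => by ring
  have h2 : ∑ i, (designMatrix z).mulVec x i * (designMatrix z).mulVec x i
      = Fintype.card m * t ^ 2 + ∑ i, w i ^ 2 := by
    have : ∀ i, (designMatrix z).mulVec x i * (designMatrix z).mulVec x i
        = t ^ 2 + 2 * t * w i + w i ^ 2 := fun i => by rw [h1]; ring
    simp_rw [this, Finset.sum_add_distrib, ← Finset.mul_sum, h0]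
    simp
  rw [h2]
  have : (0 : ℝ) ≤ Fintype.card m * t ^ 2 := by positivity
  linarith

lemma CorrBoundedBelow.isUnit_gram [Nonempty (Fin p)] (hc : 0 < c) (h : CorrBoundedBelow c z) :
    IsUnit (gramMatrix z) := by
  have hcard := (h.sampleCov_pos hc (Classical.arbitrary _)).2
  have : Nonempty m := by
    by_contra hm
    rw [not_nonempty_iff] at hm
    simp at hcard
    linarith
  rw [← Matrix.mulVec_injective_iff_isUnit, ← Matrix.coe_mulVecLin, ← LinearMap.ker_eq_bot,
    LinearMap.ker_eq_bot']
  intro x hx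
  rw [Matrix.mulVecLin_apply] at hx
  have h1 := h.sum_centredSS_le_gram hc x
  rw [hx, dotProduct_zero] at h1
  have h2 : ∀ l : Fin p, 0 ≤ centredSS z l * x l.succ ^ 2 := fun l =>
    mul_nonneg (centredSS_nonneg z l) (sq_nonneg _)
  have h3 : ∑ l : Fin p, centredSS z l * x l.succ ^ 2 = 0 :=
    le_antisymm (nonpos_of_mul_nonpos_right h1 hc) (Finset.sum_nonneg fun l _ => h2 l)
  have h4 : ∀ l : Fin p, x l.succ = 0 := by
    intro l
    have := (Finset.sum_eq_zero_iff_of_nonneg fun l _ => h2 l).1 h3 l (Finset.mem_univ _)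
    simpa [(h.centredSS_pos hc l).ne'] using this
  have h5 := dotProduct_gramMatrix_mulVec z x x
  rw [hx, dotProduct_zero] at h5
  have h6 := (Finset.sum_eq_zero_iff_of_nonneg fun i _ => mul_self_nonneg _).1 h5.symm
    (Classical.arbitrary m) (Finset.mem_univ _)
  simp [designMatrix_mulVec, h4] at h6
  funext l
  exact Fin.cases h6 h4 l

lemma inv_gram_mulVec_single (hG : IsUnit (gramMatrix z)) (j : Fin (p + 1)) :
    (gramMatrix z).mulVec ((gramMatrix z)⁻¹.mulVec (Pi.single j 1)) = Pi.single j 1 := by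
  rw [Matrix.mulVec_mulVec, Matrix.mul_nonsing_inv _ ((Matrix.isUnit_iff_isUnit_det _).1 hG),
    Matrix.one_mulVec]

/-- Variance inflation is at most `1 / λ_min` of the correlation matrix. -/
lemma CorrBoundedBelow.inv_gram_le (hc : 0 < c) (h : CorrBoundedBelow c z) (j : Fin p) :
    (gramMatrix z)⁻¹ j.succ j.succ ≤ 1 / (c * centredSS z j) := by
  have : Nonempty (Fin p) := ⟨j⟩
  have hG := h.isUnit_gram hc
  set x := (gramMatrix z)⁻¹.mulVec (Pi.single j.succ 1) with hx
  have hxj : (gramMatrix z)⁻¹ j.succ j.succ = x j.succ := by simp [hx]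
  have h1 := h.sum_centredSS_le_gram hc x
  rw [inv_gram_mulVec_single hG, dotProduct_single_one] at h1
  have h2 : centredSS z j * x j.succ ^ 2 ≤ ∑ l : Fin p, centredSS z l * x l.succ ^ 2 :=
    Finset.single_le_sum (f := fun l : Fin p => centredSS z l * x l.succ ^ 2)
      (fun l _ => mul_nonneg (centredSS_nonneg z l) (sq_nonneg _)) (Finset.mem_univ j)
  have h3 : (c * centredSS z j) * x j.succ ^ 2 ≤ x j.succ := by
    have := mul_le_mul_of_nonneg_left h2 hc.le
    linarith
  have hs : 0 < c * centredSS z j := mul_pos hc (h.centredSS_pos hc j)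
  rw [hxj, le_div_iff₀ hs]
  by_contra hgt
  have hpos : 0 < x j.succ := by
    by_contra hn
    have := mul_nonpos_of_nonpos_of_nonneg (not_lt.1 hn) hs.le
    linarith
  have := mul_lt_mul_of_pos_right (not_le.1 hgt) hpos
  nlinarith

/-- The slope variance is at least the one of simple regression on the `j`-th covariate
(Cauchy–Schwarz). -/
lemma inv_centredSS_le_inv_gram (hG : IsUnit (gramMatrix z)) (j : Fin p)
    (hj : 0 < centredSS z j) :
    1 / centredSS z j ≤ (gramMatrix z)⁻¹ j.succ j.succ := by
  set x := (gramMatrix z)⁻¹.mulVec (Pi.single j.succ 1) with hx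
  have hxj : (gramMatrix z)⁻¹ j.succ j.succ = x j.succ := by simp [hx]
  -- the vector whose image under the design matrix is the centred column `j`
  set w : Fin (p + 1) → ℝ := Fin.cons (-sampleMean z j) (Pi.single j 1) with hw
  have hXw : ∀ i, (designMatrix z).mulVec w i = z i j - sampleMean z j := by
    intro i
    rw [designMatrix_mulVec]
    simp [hw, Pi.single_apply]
    ring
  have h1 : ∑ i, (designMatrix z).mulVec w i * (designMatrix z).mulVec x i = 1 := by
    rw [← dotProduct_gramMatrix_mulVec, inv_gram_mulVec_single hG, dotProduct_single_one]
    simp [hw]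
  have h2 : ∑ i, (designMatrix z).mulVec x i ^ 2 = x j.succ := by
    simp_rw [sq]
    rw [← dotProduct_gramMatrix_mulVec, inv_gram_mulVec_single hG, dotProduct_single_one]
  have h3 : ∑ i, (designMatrix z).mulVec w i ^ 2 = centredSS z j := by
    simp_rw [hXw]; rfl
  have := Finset.sum_mul_sq_le_sq_mul_sq Finset.univ (fun i => (designMatrix z).mulVec w i)
    (fun i => (designMatrix z).mulVec x i)
  rw [h1, h2, h3] at this
  rw [hxj, div_le_iff₀ hj]
  linarith

/-- Weights of the `q`-th coefficient of the least-squares estimator. -/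
noncomputable def olsWeights (z : m → Fin p → ℝ) (q : Fin (p + 1)) (i : m) : ℝ :=
  ((gramMatrix z)⁻¹ * (designMatrix z).transpose) q i

lemma olsEstimator_eq_sum (y : m → ℝ) (q : Fin (p + 1)) :
    olsEstimator (designMatrix z) y q = ∑ i, olsWeights z q i * y i := by
  rw [olsEstimator, Matrix.mulVec_mulVec]
  rfl

/-- This also holds for a singular Gram matrix, because its inverse is then `0`. -/
lemma sum_olsWeights_sq (q : Fin (p + 1)) :
    ∑ i, olsWeights z q i ^ 2 = (gramMatrix z)⁻¹ q q := by
  have hs : (gramMatrix z).transpose = gramMatrix z := by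
    simp [gramMatrix, Matrix.transpose_mul]
  have h1 : ∑ i, olsWeights z q i ^ 2
      = (((gramMatrix z)⁻¹ * (designMatrix z).transpose)
          * ((gramMatrix z)⁻¹ * (designMatrix z).transpose).transpose) q q := by
    rw [Matrix.mul_apply]
    exact Finset.sum_congr rfl fun i _ => by rw [Matrix.transpose_apply, sq]; rfl
  rw [h1, Matrix.transpose_mul, Matrix.transpose_transpose, Matrix.transpose_nonsing_inv, hs,
    Matrix.mul_assoc, ← Matrix.mul_assoc (designMatrix z).transpose]
  change ((gramMatrix z)⁻¹ * (gramMatrix z * (gramMatrix z)⁻¹)) q q = _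
  by_cases hG : IsUnit (gramMatrix z)
  · rw [Matrix.mul_nonsing_inv _ ((Matrix.isUnit_iff_isUnit_det _).1 hG), Matrix.mul_one]
  · rw [Matrix.nonsing_inv_apply_not_isUnit _ fun h => hG ((Matrix.isUnit_iff_isUnit_det _).2 h)]
    simp

/-- If the column takes `r` values below `a` and `r` values above `b`, then its sum of squares is
of order at least `r (b - a)²`: one of the two groups is far from the mean. -/
lemma le_centredSS {r : ℕ} {a b : ℝ} (hab : a ≤ b) (j : Fin p)
    (ha : r ≤ (Finset.univ.filter fun i => z i j ≤ a).card)
    (hb : r ≤ (Finset.univ.filter fun i => b ≤ z i j).card) :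
    r * (b - a) ^ 2 / 4 ≤ centredSS z j := by
  have key : ∀ s : Finset m, r ≤ s.card →
      (∀ i ∈ s, (b - a) ^ 2 / 4 ≤ (z i j - sampleMean z j) ^ 2) →
      r * (b - a) ^ 2 / 4 ≤ centredSS z j := by
    intro s hs hle
    calc (r : ℝ) * (b - a) ^ 2 / 4 ≤ s.card * ((b - a) ^ 2 / 4) := by
          rw [mul_div_assoc]
          gcongr
      _ ≤ ∑ i ∈ s, (z i j - sampleMean z j) ^ 2 := by
          rw [← nsmul_eq_mul]
          exact Finset.card_nsmul_le_sum _ _ _ hle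
      _ ≤ centredSS z j :=
          Finset.sum_le_sum_of_subset_of_nonneg (Finset.subset_univ _) fun _ _ _ => sq_nonneg _
  rcases le_total (sampleMean z j) ((a + b) / 2) with h | h
  · refine key _ hb fun i hi => ?_
    have := (Finset.mem_filter.1 hi).2
    nlinarith
  · refine key _ ha fun i hi => ?_
    have := (Finset.mem_filter.1 hi).2
    nlinarith

lemma centredSS_le {a b : ℝ} (j : Fin p) (h : ∀ i, a ≤ z i j ∧ z i j ≤ b) :
    centredSS z j ≤ Fintype.card m * (b - a) ^ 2 := by
  rcases isEmpty_or_nonempty m with hm | hm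
  · simp [centredSS]
  have hN : (0 : ℝ) < Fintype.card m := by exact_mod_cast Fintype.card_pos
  have h1 : a ≤ sampleMean z j := by
    rw [sampleMean, le_div_iff₀ hN, mul_comm, ← nsmul_eq_mul]
    exact Finset.card_nsmul_le_sum _ _ _ fun i _ => (h i).1
  have h2 : sampleMean z j ≤ b := by
    rw [sampleMean, div_le_iff₀ hN, mul_comm b, ← nsmul_eq_mul]
    exact Finset.sum_le_card_nsmul _ _ _ fun i _ => (h i).2
  rw [centredSS, ← nsmul_eq_mul]
  refine Finset.sum_le_card_nsmul _ _ _ fun i _ => ?_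
  have := h i
  rw [sq_le_sq, abs_of_nonneg (show 0 ≤ b - a by linarith), abs_le]
  constructor <;> linarith

end Gram

lemma isHermitian_sampleCorr {m : Type*} [Fintype m] {p : ℕ} (z : m → Fin p → ℝ) :
    (sampleCorr z).IsHermitian := by
  ext l q
  simp only [sampleCorr, Matrix.conjTranspose_apply, Matrix.of_apply, star_trivial]
  rw [mul_comm √(sampleCov z q q)]
  congr 1
  simp [sampleCov, mul_comm]

lemma corrBoundedBelow_of_lt_lambdaMin {m : Type*} [Fintype m] {p : ℕ} {c : ℝ}
    {z : m → Fin p → ℝ} (h : c < lambdaMin (sampleCorr z)) : CorrBoundedBelow c z := by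
  have hH := isHermitian_sampleCorr z
  have hsub : (sampleCorr z - c • (1 : Matrix (Fin p) (Fin p) ℝ)).PosSemidef := by
    have hH' : (sampleCorr z - c • (1 : Matrix (Fin p) (Fin p) ℝ)).IsHermitian :=
      hH.sub (by simp [Matrix.IsHermitian])
    rw [hH'.posSemidef_iff_eigenvalues_nonneg]
    intro i
    -- an eigenvalue of `R - c` is an eigenvalue of `R` diminished by `c`
    have h1 : hH'.eigenvalues i ∈ spectrum ℝ (sampleCorr z - c • 1) := by
      rw [hH'.spectrum_real_eq_range_eigenvalues]; exact ⟨i, rfl⟩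
    have h2 : hH'.eigenvalues i + c ∈ spectrum ℝ (sampleCorr z) := by
      rw [spectrum.mem_iff] at h1 ⊢
      convert h1 using 2
      rw [Algebra.algebraMap_eq_smul_one, Algebra.algebraMap_eq_smul_one, add_smul]
      abel
    have hbdd : BddBelow (spectrum ℝ (sampleCorr z)) := by
      rw [hH.spectrum_real_eq_range_eigenvalues]
      exact (Set.finite_range _).bddBelow
    have h3 := csInf_le hbdd h2
    have : lambdaMin (sampleCorr z) ≤ hH'.eigenvalues i + c := h3
    simp only [Pi.zero_apply]
    linarith
  intro x
  have := hsub.dotProduct_mulVec_nonneg x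
  rw [Matrix.sub_mulVec, dotProduct_sub, Matrix.smul_mulVec, Matrix.one_mulVec] at this
  simp only [star_trivial, dotProduct_smul, smul_eq_mul] at this
  have e1 : x ⬝ᵥ x = ∑ l, x l ^ 2 := by simp [dotProduct, sq]
  have e2 : x ⬝ᵥ (sampleCorr z).mulVec x = ∑ l, ∑ q, x l * sampleCorr z l q * x q := by
    simp [dotProduct, Matrix.mulVec, Finset.mul_sum, mul_assoc]
  rw [e1, e2] at this
  linarith

/-! ### The conditional variance of the slope estimators -/

lemma evariance_id_map {E : Type*} [MeasurableSpace E] (ρ : Measure E) {f : E → ℝ}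
    (hf : Measurable f) : evariance (fun t : ℝ => t) (ρ.map f) = evariance f ρ := by
  have h : ∫ t, t ∂(ρ.map f) = ∫ e, f e ∂ρ :=
    integral_map hf.aemeasurable measurable_id.aestronglyMeasurable
  rw [evariance, evariance, h, lintegral_map (by fun_prop) hf]

/-- Conditionally on `Z`, the first argument of `f (Z, e)` is frozen: the conditional law of
`f (Z, e)` is the image of that of `e` under `f (Z, ·)`. -/
lemma condDistrib_comp_prodMk {Ω E F : Type*} [MeasurableSpace Ω] [MeasurableSpace E]
    [MeasurableSpace F] [StandardBorelSpace F] [Nonempty F] {μ : Measure Ω} [IsFiniteMeasure μ]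
    {Z : Ω → E} {e : Ω → F} (hZ : Measurable Z) (he : AEMeasurable e μ) {f : E × F → ℝ}
    (hf : Measurable f) :
    ∀ᵐ ω ∂μ, condDistrib (fun ω => f (Z ω, e ω)) Z μ (Z ω)
      = (condDistrib e Z μ (Z ω)).map fun x => f (Z ω, x) := by
  set κ : Kernel E ℝ := (Kernel.id ×ₖ condDistrib e Z μ).map f with hκ
  have hκz : ∀ z, κ z = (condDistrib e Z μ z).map fun x => f (z, x) := by
    intro z
    rw [hκ, Kernel.map_apply _ hf, Kernel.prod_apply, Kernel.id_apply, Measure.dirac_prod,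
      Measure.map_map hf measurable_prodMk_left]
    rfl
  have hfe : AEMeasurable (fun ω => f (Z ω, e ω)) μ :=
    hf.comp_aemeasurable (hZ.aemeasurable.prodMk he)
  have key : μ.map (fun ω => (Z ω, f (Z ω, e ω))) = μ.map Z ⊗ₘ κ := by
    have h1 : μ.map (fun ω => (Z ω, f (Z ω, e ω)))
        = (μ.map fun ω => (Z ω, e ω)).map fun q : E × F => (q.1, f q) := by
      rw [AEMeasurable.map_map_of_aemeasurable (measurable_fst.prodMk hf).aemeasurable
        (hZ.aemeasurable.prodMk he)]
      rfl
    rw [h1, ← compProd_map_condDistrib he]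
    refine Measure.ext_of_lintegral _ fun g hg => ?_
    have hg' : Measurable fun q : E × F => g (q.1, f q) := hg.comp (measurable_fst.prodMk hf)
    rw [lintegral_map hg (measurable_fst.prodMk hf), Measure.lintegral_compProd hg',
      Measure.lintegral_compProd hg]
    refine lintegral_congr fun z => ?_
    have hgz : Measurable fun t => g (z, t) := hg.comp measurable_prodMk_left
    have hfz : Measurable fun x => f (z, x) := hf.comp measurable_prodMk_left
    rw [hκz, lintegral_map hgz hfz]
  have := condDistrib_ae_eq_of_measure_eq_compProd Z hfe key
  filter_upwards [ae_of_ae_map hZ.aemeasurable this] with ω hω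
  rw [hω, hκz]

/-- The variance of an affine combination of centred uncorrelated variables of variance `σ²`. -/
lemma evariance_affine {ι κ : Type*} [Fintype κ] [DecidableEq ι]
    {ρ : Measure (ι → ℝ)} [IsProbabilityMeasure ρ] {σ : ℝ}
    (h2 : ∀ i, MemLp (fun e : ι → ℝ => e i) 2 ρ)
    (hmean : ∀ i, ∫ e, e i ∂ρ = 0)
    (hcov : ∀ i l, ∫ e, e i * e l ∂ρ = if i = l then σ ^ 2 else 0)
    {g : κ → ι} (hg : Function.Injective g) (a : κ → ℝ) (b : ℝ) :
    evariance (fun e : ι → ℝ => b + ∑ k, a k * e (g k)) ρ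
      = ENNReal.ofReal (σ ^ 2 * ∑ k, a k ^ 2) := by
  have hlin : MemLp (fun e : ι → ℝ => ∑ k, a k * e (g k)) 2 ρ :=
    memLp_finsetSum _ fun k _ => (h2 (g k)).const_mul (a k)
  have hT : MemLp (fun e : ι → ℝ => b + ∑ k, a k * e (g k)) 2 ρ := (memLp_const b).add hlin
  have hint : ∀ k, Integrable (fun e : ι → ℝ => a k * e (g k)) ρ := fun k =>
    ((h2 (g k)).integrable one_le_two).const_mul _
  have hm : ∫ e, (b + ∑ k, a k * e (g k)) ∂ρ = b := by
    rw [integral_add (integrable_const b) (hlin.integrable one_le_two), integral_finsetSum _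
      fun k _ => hint k]
    simp [integral_const_mul, hmean]
  rw [← hT.ofReal_variance_eq, variance_eq_integral hT.aemeasurable, hm]
  congr 1
  have hexp : ∀ e : ι → ℝ, (b + ∑ k, a k * e (g k) - b) ^ 2
      = ∑ k, ∑ l, (a k * a l) * (e (g k) * e (g l)) := by
    intro e
    rw [add_sub_cancel_left, sq, Finset.sum_mul_sum]
    exact Finset.sum_congr rfl fun k _ => Finset.sum_congr rfl fun l _ => by ring
  have hint2 : ∀ k l, Integrable (fun e : ι → ℝ => (a k * a l) * (e (g k) * e (g l))) ρ :=
    fun k l => ((h2 (g k)).integrable_mul (h2 (g l))).const_mul _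
  simp_rw [hexp]
  rw [integral_finsetSum _ fun k _ => integrable_finsetSum _ fun l _ => hint2 k l]
  classical
  simp_rw [integral_finsetSum _ fun l _ => hint2 _ l, integral_const_mul, hcov, hg.eq_iff]
  simp [Finset.mul_sum]
  exact Finset.sum_congr rfl fun k _ => by ring

/-- A function that depends on the selected rows is measurable if it is so for every fixed
selection. -/
lemma measurable_of_measurableSet_fiber {E α : Type*} [MeasurableSpace E] [Fintype α]
    {sel : E → α} {F : Type*} [MeasurableSpace F] (hsel : ∀ S, MeasurableSet {z | sel z = S})
    {h : α → E → F → ℝ} (hh : ∀ S, Measurable fun q : E × F => h S q.1 q.2) :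
    Measurable fun q : E × F => h (sel q.1) q.1 q.2 := by
  let _ : MeasurableSpace α := ⊤
  have hs : Measurable sel := measurable_to_countable' fun S => hsel S
  have : Measurable fun q : α × (E × F) => h q.1 q.2.1 q.2.2 :=
    measurable_from_prod_countable_right fun S => hh S
  exact this.comp ((hs.comp measurable_fst).prodMk measurable_id)

lemma measurable_olsWeights {m : Type*} [Fintype m] {p : ℕ} (q : Fin (p + 1)) (i : m) :
    Measurable fun z : m → Fin p → ℝ => olsWeights z q i := by
  have hX : Continuous fun z : m → Fin p → ℝ => designMatrix z := by
    refine continuous_matrix fun a b => ?_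
    refine Fin.cases ?_ (fun l => ?_) b
    · simpa [designMatrix] using continuous_const
    · simp only [designMatrix, Matrix.of_apply, Fin.cons_succ]
      fun_prop
  have hG : Continuous fun z : m → Fin p → ℝ => gramMatrix z := hX.matrix_transpose.matrix_mul hX
  have hN : Measurable fun z : m → Fin p → ℝ =>
      ((gramMatrix z).adjugate * (designMatrix z).transpose) q i :=
    ((hG.matrix_adjugate.matrix_mul hX.matrix_transpose).matrix_elem q i).measurable
  have hd : Measurable fun z : m → Fin p → ℝ => (gramMatrix z).det := hG.matrix_det.measurable
  have : (fun z : m → Fin p → ℝ => olsWeights z q i) = fun z =>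
      (gramMatrix z).det⁻¹ * ((gramMatrix z).adjugate * (designMatrix z).transpose) q i := by
    funext z
    simp [olsWeights, Matrix.inv_def, Ring.inverse_eq_inv']
  rw [this]
  exact hd.inv.mul hN

/-- In the linear model the conditional variance given the covariates of a least-squares
coefficient computed from selected rows is `σ² [(Xᵀ X)⁻¹]_qq`, `X` the selected design matrix. -/
lemma condVarGiven_subdataEstimator {Ω : Type*} [MeasurableSpace Ω] {μ : Measure Ω}
    [IsProbabilityMeasure μ] {n p : ℕ} {Z : Ω → Fin n → Fin p → ℝ} (hZ : Measurable Z)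
    {σ : ℝ} {β : Fin (p + 1) → ℝ} {ε Y : Ω → Fin n → ℝ}
    (hY : ∀ ω i, Y ω i = β 0 + (∑ j : Fin p, Z ω i j * β j.succ) + ε ω i)
    (hε2 : ∀ i, MemLp (fun ω => ε ω i) 2 μ)
    (hε_mean : ∀ i, μ[fun ω => ε ω i | MeasurableSpace.comap Z inferInstance] =ᵐ[μ] fun _ => 0)
    (hε_cov : ∀ i l, μ[fun ω => ε ω i * ε ω l | MeasurableSpace.comap Z inferInstance]
      =ᵐ[μ] fun _ => if i = l then σ ^ 2 else 0)
    {sel : (Fin n → Fin p → ℝ) → Finset (Fin n)} (hsel : ∀ S, MeasurableSet {z | sel z = S})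
    (q : Fin (p + 1)) :
    ∀ᵐ ω ∂μ, condVarGiven μ (fun ω => subdataEstimator (sel (Z ω)) (Z ω) (Y ω) q) Z ω
      = ENNReal.ofReal (σ ^ 2 * (gramMatrix (restrictRows (sel (Z ω)) (Z ω)))⁻¹ q q) := by
  have hε : AEMeasurable ε μ := aemeasurable_pi_lambda _ fun i => (hε2 i).aemeasurable
  set κ := condDistrib ε Z μ with hκ
  set h : Finset (Fin n) → (Fin n → Fin p → ℝ) → (Fin n → ℝ) → ℝ := fun S z e =>
    (∑ i : S, olsWeights (restrictRows S z) q i * (β 0 + ∑ j : Fin p, z i j * β j.succ))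
      + ∑ i : S, olsWeights (restrictRows S z) q i * e i with hh
  have hmeas : Measurable fun x : (Fin n → Fin p → ℝ) × (Fin n → ℝ) => h (sel x.1) x.1 x.2 := by
    refine measurable_of_measurableSet_fiber hsel fun S => ?_
    have hr : Measurable fun z : Fin n → Fin p → ℝ => restrictRows S z :=
      measurable_pi_lambda _ fun i => measurable_pi_apply _
    have hw : ∀ i : S, Measurable fun x : (Fin n → Fin p → ℝ) × (Fin n → ℝ) =>
        olsWeights (restrictRows S x.1) q i :=
      fun i => (measurable_olsWeights q i).comp (hr.comp measurable_fst)
    have hz : ∀ (i : S) (j : Fin p), Measurable fun x : (Fin n → Fin p → ℝ) × (Fin n → ℝ) =>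
        x.1 i j := fun i j => (measurable_pi_apply j).comp
          ((measurable_pi_apply (i : Fin n)).comp measurable_fst)
    have he : ∀ (i : S), Measurable fun x : (Fin n → Fin p → ℝ) × (Fin n → ℝ) =>
        x.2 i := fun i => (measurable_pi_apply (i : Fin n)).comp measurable_snd
    refine Measurable.add (Finset.measurable_fun_sum _ fun i _ => (hw i).mul ?_)
      (Finset.measurable_fun_sum _ fun i _ => (hw i).mul (he i))
    exact measurable_const.add (Finset.measurable_fun_sum _ fun j _ => (hz i j).mul_const _)
  have hT : (fun ω => subdataEstimator (sel (Z ω)) (Z ω) (Y ω) q)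
      = fun ω => h (sel (Z ω)) (Z ω) (ε ω) := by
    funext ω
    rw [subdataEstimator, olsEstimator_eq_sum]
    simp only [hh, ← Finset.sum_add_distrib, ← mul_add]
    exact Finset.sum_congr rfl fun i _ => by simp only [restrictRows, hY]
  have hmean : ∀ i, ∀ᵐ ω ∂μ, ∫ e, e i ∂κ (Z ω) = 0 := by
    intro i
    have := condExp_ae_eq_integral_condDistrib (f := fun e : Fin n → ℝ => e i) hZ hε
      (measurable_pi_apply i).stronglyMeasurable ((hε2 i).integrable one_le_two)
    filter_upwards [this, hε_mean i] with ω h1 h2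
    rw [← h1, h2]
  have hcov : ∀ i l, ∀ᵐ ω ∂μ, ∫ e, e i * e l ∂κ (Z ω) = if i = l then σ ^ 2 else 0 := by
    intro i l
    have := condExp_ae_eq_integral_condDistrib (f := fun e : Fin n → ℝ => e i * e l) hZ hε
      ((measurable_pi_apply i).mul (measurable_pi_apply l)).stronglyMeasurable
      ((hε2 i).integrable_mul (hε2 l))
    filter_upwards [this, hε_cov i l] with ω h1 h2
    rw [← h1, h2]
  have hL2 : ∀ i, ∀ᵐ ω ∂μ, MemLp (fun e : Fin n → ℝ => e i) 2 (κ (Z ω)) := by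
    intro i
    have hi : Integrable (fun x : (Fin n → Fin p → ℝ) × (Fin n → ℝ) => x.2 i ^ 2)
        (μ.map fun ω => (Z ω, ε ω)) := by
      have hm : Measurable fun x : (Fin n → Fin p → ℝ) × (Fin n → ℝ) => x.2 i ^ 2 :=
        ((measurable_pi_apply i).comp measurable_snd).pow_const 2
      rw [integrable_map_measure hm.aestronglyMeasurable (hZ.aemeasurable.prodMk hε)]
      exact (hε2 i).integrable_sq
    filter_upwards [hi.condDistrib_ae hZ.aemeasurable hε] with ω hω
    exact (memLp_two_iff_integrable_sq (measurable_pi_apply i).aestronglyMeasurable).2 hω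
  have hcd := condDistrib_comp_prodMk (μ := μ) hZ hε hmeas
  filter_upwards [hcd, ae_all_iff.2 hmean, ae_all_iff.2 fun i => ae_all_iff.2 (hcov i),
    ae_all_iff.2 hL2] with ω h1 h2 h3 h4
  have hm : Measurable fun x => h (sel (Z ω)) (Z ω) x := hmeas.comp measurable_prodMk_left
  rw [condVarGiven, hT, h1, evariance_id_map _ hm]
  simp only [hh]
  rw [evariance_affine h4 h2 h3 Subtype.val_injective, sum_olsWeights_sq]

/-! ### Order statistics and the selected rows -/

/-- The infimum in the definition of the order statistic is attained. -/
lemma isLeast_orderStat {n : ℕ} (x : Fin n → ℝ) {m : ℕ} (h1 : 1 ≤ m) (hn : m ≤ n) :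
    IsLeast {t : ℝ | m ≤ (Finset.univ.filter (fun i => x i ≤ t)).card} (orderStat x m) := by
  set T : Set ℝ := {t : ℝ | m ≤ (Finset.univ.filter (fun i => x i ≤ t)).card} with hT
  -- below every element of `T` there is a data point that belongs to `T`
  have hdata : ∀ t ∈ T, ∃ i, x i ∈ T ∧ x i ≤ t := by
    intro t ht
    have hne : (Finset.univ.filter (fun i => x i ≤ t)).Nonempty :=
      Finset.card_pos.1 (lt_of_lt_of_le h1 ht)
    obtain ⟨i, hi, hmax⟩ := Finset.exists_max_image _ x hne
    refine ⟨i, le_trans (show m ≤ _ from ht) (Finset.card_le_card fun l hl => ?_),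
      (Finset.mem_filter.1 hi).2⟩
    exact Finset.mem_filter.2 ⟨Finset.mem_univ _, hmax l hl⟩
  have hTne : T.Nonempty := by
    have hnp : 0 < n := lt_of_lt_of_le h1 hn
    have : Nonempty (Fin n) := ⟨⟨0, hnp⟩⟩
    obtain ⟨i, _, hi⟩ := Finset.exists_max_image Finset.univ x Finset.univ_nonempty
    refine ⟨x i, ?_⟩
    simp only [hT, Set.mem_ofPred_eq]
    rw [Finset.filter_true_of_mem fun l hl => hi l hl]
    simpa using hn
  classical
  set D : Finset (Fin n) := Finset.univ.filter fun i => x i ∈ T with hD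
  have hDne : D.Nonempty := by
    obtain ⟨t, ht⟩ := hTne
    obtain ⟨i, hi, _⟩ := hdata t ht
    exact ⟨i, Finset.mem_filter.2 ⟨Finset.mem_univ _, hi⟩⟩
  obtain ⟨i, hi, hmin⟩ := Finset.exists_min_image D x hDne
  have hleast : IsLeast T (x i) := by
    refine ⟨(Finset.mem_filter.1 hi).2, fun t ht => ?_⟩
    obtain ⟨l, hl, hlt⟩ := hdata t ht
    exact (hmin l (Finset.mem_filter.2 ⟨Finset.mem_univ _, hl⟩)).trans hlt
  have : orderStat x m = x i := hleast.csInf_eq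
  rw [this]
  exact hleast

lemma le_card_le_orderStat {n : ℕ} (x : Fin n → ℝ) {m : ℕ} (h1 : 1 ≤ m) (hn : m ≤ n) :
    m ≤ (Finset.univ.filter (fun i => x i ≤ orderStat x m)).card :=
  (isLeast_orderStat x h1 hn).1

lemma orderStat_le {n : ℕ} (x : Fin n → ℝ) {m : ℕ} (h1 : 1 ≤ m) {t : ℝ}
    (ht : m ≤ (Finset.univ.filter (fun i => x i ≤ t)).card) : orderStat x m ≤ t :=
  (isLeast_orderStat x h1 (ht.trans
    (by simpa using Finset.card_filter_le Finset.univ fun i => x i ≤ t))).2 ht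

lemma le_orderStat {n : ℕ} (x : Fin n → ℝ) {m : ℕ} (h1 : 1 ≤ m) (hn : m ≤ n) {t : ℝ}
    (ht : (Finset.univ.filter (fun i => x i < t)).card < m) : t ≤ orderStat x m := by
  by_contra hlt
  refine absurd (le_card_le_orderStat x h1 hn) (not_le.2 (lt_of_le_of_lt ?_ ht))
  refine Finset.card_le_card fun i hi => ?_
  simp only [Finset.mem_filter, Finset.mem_univ, true_and] at hi ⊢
  exact hi.trans_lt (not_le.1 hlt)

lemma orderStat_mono {n : ℕ} (x : Fin n → ℝ) {m m' : ℕ} (h1 : 1 ≤ m) (h : m ≤ m') (hn : m' ≤ n) :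
    orderStat x m ≤ orderStat x m' :=
  orderStat_le x h1 (h.trans (le_card_le_orderStat x (h1.trans h) hn))

lemma card_filter_lt_add_card_filter_le {n : ℕ} (x : Fin n → ℝ) (t : ℝ) :
    (Finset.univ.filter (fun i => x i < t)).card + (Finset.univ.filter (fun i => t ≤ x i)).card
      = n := by
  have := Finset.card_filter_add_card_filter_not (s := (Finset.univ : Finset (Fin n)))
    (fun i => x i < t)
  simpa using this

lemma le_orderStat_of_le_card {n : ℕ} (x : Fin n → ℝ) {r : ℕ} (h1 : 1 ≤ r) (hn : r ≤ n) {t : ℝ}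
    (ht : r ≤ (Finset.univ.filter (fun i => t ≤ x i)).card) : t ≤ orderStat x (n - r + 1) := by
  have := card_filter_lt_add_card_filter_le x t
  exact le_orderStat x (by omega) (by omega) (by omega)

lemma le_card_orderStat_le {n : ℕ} (x : Fin n → ℝ) {r : ℕ} (hn : r ≤ n) :
    r ≤ (Finset.univ.filter (fun i => orderStat x (n - r + 1) ≤ x i)).card := by
  set o := orderStat x (n - r + 1) with ho
  have hsum := card_filter_lt_add_card_filter_le x o
  by_contra hlt
  have hcard : n - r + 1 ≤ (Finset.univ.filter (fun i => x i < o)).card := by omega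
  obtain ⟨i, hi, hmax⟩ := Finset.exists_max_image (Finset.univ.filter (fun i => x i < o)) x
    (Finset.card_pos.1 (by omega))
  have : o ≤ x i := orderStat_le x (by omega) (hcard.trans (Finset.card_le_card fun l hl =>
    Finset.mem_filter.2 ⟨Finset.mem_univ _, hmax l hl⟩))
  exact absurd (Finset.mem_filter.1 hi).2 (not_lt.2 this)

lemma orderStat_one_le {n : ℕ} (x : Fin n → ℝ) (i : Fin n) : orderStat x 1 ≤ x i :=
  orderStat_le x le_rfl (Finset.card_pos.2 ⟨i, by simp⟩)

lemma le_orderStat_last {n : ℕ} (x : Fin n → ℝ) (i : Fin n) : x i ≤ orderStat x n := by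
  have hn : 1 ≤ n := lt_of_le_of_lt (Nat.zero_le _) i.2
  have := le_orderStat_of_le_card x le_rfl hn (t := x i) (Finset.card_pos.2 ⟨i, by simp⟩)
  rwa [Nat.sub_add_cancel hn] at this

lemma card_filter_restrictRows {n p : ℕ} (S : Finset (Fin n)) (z : Fin n → Fin p → ℝ) (j : Fin p)
    (P : ℝ → Prop) [DecidablePred P] :
    (Finset.univ.filter fun i : S => P (restrictRows S z i j)).card
      = (S.filter fun i => P (z i j)).card := by
  rw [← Finset.card_map (Function.Embedding.subtype _)]
  congr 1
  ext i
  rw [Finset.mem_map, Finset.mem_filter]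
  constructor
  · rintro ⟨l, hl, rfl⟩
    exact ⟨l.2, (Finset.mem_filter.1 hl).2⟩
  · rintro ⟨hi, hP⟩
    exact ⟨⟨i, hi⟩, Finset.mem_filter.2 ⟨Finset.mem_univ _, hP⟩, rfl⟩

namespace IsIBOSSSubset

variable {n p r : ℕ} {z : Fin n → Fin p → ℝ} {S : Finset (Fin n)}

/-- Rows that are no longer available when covariate `j` is processed have been selected. -/
lemma mem_of_notMem_remainingRows {L U : Fin p → Finset (Fin n)} {j : Fin p} {i : Fin n}
    (hi : i ∉ remainingRows L U j) : i ∈ Finset.univ.biUnion (fun j => L j ∪ U j) := by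
  simp only [remainingRows, Finset.mem_sdiff, Finset.mem_univ, true_and, not_not,
    Finset.mem_biUnion, Finset.mem_filter] at hi ⊢
  obtain ⟨l, _, hl⟩ := hi
  exact ⟨l, hl⟩

/-- The subdata contain as many small values as the full data, up to `r` of them: if `L j` misses a
row with `z i j ≤ t`, then it consists of such rows. -/
lemma le_card_le (h : IsIBOSSSubset r z S) (j : Fin p) (t : ℝ) {m : ℕ} (hm : m ≤ r)
    (ht : m ≤ (Finset.univ.filter fun i => z i j ≤ t).card) :
    m ≤ (S.filter fun i => z i j ≤ t).card := by
  obtain ⟨L, U, hLU, rfl⟩ := h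
  obtain ⟨hLs, -, -, hLc, -, hLmin, -⟩ := hLU j
  have hLS : L j ⊆ Finset.univ.biUnion (fun j => L j ∪ U j) := fun i hi =>
    Finset.mem_biUnion.2 ⟨j, Finset.mem_univ _, Finset.mem_union_left _ hi⟩
  by_cases hall : ∀ i ∈ L j, z i j ≤ t
  · refine hm.trans (hLc ▸ Finset.card_le_card fun i hi => ?_)
    exact Finset.mem_filter.2 ⟨hLS hi, hall i hi⟩
  · push Not at hall
    obtain ⟨i₀, hi₀, hlt⟩ := hall
    refine ht.trans (Finset.card_le_card fun i hi => ?_)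
    have hit := (Finset.mem_filter.1 hi).2
    refine Finset.mem_filter.2 ⟨?_, hit⟩
    by_cases hrem : i ∈ remainingRows L U j
    · by_cases hiL : i ∈ L j
      · exact hLS hiL
      · have := hLmin i₀ hi₀ i (Finset.mem_sdiff.2 ⟨hrem, hiL⟩)
        linarith
    · exact mem_of_notMem_remainingRows hrem

/-- The subdata contain as many large values as the full data, up to `r` of them. -/
lemma le_card_ge (h : IsIBOSSSubset r z S) (j : Fin p) (t : ℝ) {m : ℕ} (hm : m ≤ r)
    (ht : m ≤ (Finset.univ.filter fun i => t ≤ z i j).card) :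
    m ≤ (S.filter fun i => t ≤ z i j).card := by
  obtain ⟨L, U, hLU, rfl⟩ := h
  obtain ⟨-, hUs, -, -, hUc, -, hUmax⟩ := hLU j
  have hUS : U j ⊆ Finset.univ.biUnion (fun j => L j ∪ U j) := fun i hi =>
    Finset.mem_biUnion.2 ⟨j, Finset.mem_univ _, Finset.mem_union_right _ hi⟩
  by_cases hall : ∀ i ∈ U j, t ≤ z i j
  · refine hm.trans (hUc ▸ Finset.card_le_card fun i hi => ?_)
    exact Finset.mem_filter.2 ⟨hUS hi, hall i hi⟩
  · push Not at hall
    obtain ⟨i₀, hi₀, hlt⟩ := hall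
    refine ht.trans (Finset.card_le_card fun i hi => ?_)
    have hit := (Finset.mem_filter.1 hi).2
    refine Finset.mem_filter.2 ⟨?_, hit⟩
    by_cases hrem : i ∈ remainingRows L U j
    · by_cases hiU : i ∈ U j
      · exact hUS hiU
      · have := hUmax i₀ hi₀ i (Finset.mem_sdiff.2 ⟨hrem, hiU⟩)
        linarith
    · exact mem_of_notMem_remainingRows hrem

lemma card_le (h : IsIBOSSSubset r z S) : S.card ≤ 2 * p * r := by
  obtain ⟨L, U, hLU, rfl⟩ := h
  refine Finset.card_biUnion_le.trans
    ((Finset.sum_le_card_nsmul _ _ (2 * r) fun j _ => ?_).trans ?_)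
  · refine (Finset.card_union_le _ _).trans ?_
    obtain ⟨-, -, -, h1, h2, -⟩ := hLU j
    omega
  · simp only [Finset.card_univ, Fintype.card_fin, smul_eq_mul]
    exact le_of_eq (by ring)

/-- Spread of a covariate in the subdata, in terms of order statistics of the full data. -/
lemma le_centredSS (h : IsIBOSSSubset r z S) (j : Fin p) {m : ℕ} (h1 : 1 ≤ m) (hm : m ≤ r)
    (hn : 2 * m ≤ n) :
    m * (orderStat (fun i => z i j) (n - m + 1) - orderStat (fun i => z i j) m) ^ 2 / 4
      ≤ centredSS (restrictRows S z) j := by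
  refine _root_.le_centredSS (orderStat_mono _ h1 (by omega) (by omega)) j ?_ ?_
  · rw [card_filter_restrictRows S z j fun t => t ≤ orderStat (fun i => z i j) m]
    exact h.le_card_le j _ hm (le_card_le_orderStat (fun i => z i j) h1 (by omega))
  · rw [card_filter_restrictRows S z j fun t => orderStat (fun i => z i j) (n - m + 1) ≤ t]
    exact h.le_card_ge j _ hm (le_card_orderStat_le (fun i => z i j) (by omega))

lemma centredSS_le (h : IsIBOSSSubset r z S) (j : Fin p) :
    centredSS (restrictRows S z) j ≤ (2 * p * r : ℕ)
      * (orderStat (fun i => z i j) n - orderStat (fun i => z i j) 1) ^ 2 := by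
  refine (_root_.centredSS_le (z := restrictRows S z) j fun i =>
    ⟨orderStat_one_le (fun i => z i j) i, le_orderStat_last (fun i => z i j) i⟩).trans ?_
  have : (Fintype.card S : ℝ) ≤ (2 * p * r : ℕ) := by
    rw [Fintype.card_coe]
    exact_mod_cast h.card_le
  exact mul_le_mul_of_nonneg_right this (sq_nonneg _)

end IsIBOSSSubset

/-! ### Extremes of independent samples -/

section Counting

variable {Ω : Type*} [MeasurableSpace Ω] {μ : Measure Ω}

/-- Chebyshev's inequality for the number of observations in an upper tail. -/
lemma measure_card_lt_le [IsProbabilityMeasure μ] {n : ℕ} {X : Fin n → Ω → ℝ}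
    (hX : ∀ i, Measurable (X i))
    (hind : iIndepFun X μ) {ν : Measure ℝ} (hν : ∀ i, μ.map (X i) = ν) {b : ℝ} {r : ℕ}
    (hpos : 0 < n * ν.real (Set.Ici b)) (hr : (r : ℝ) ≤ n * ν.real (Set.Ici b) / 2) :
    μ {ω | (Finset.univ.filter fun i => b ≤ X i ω).card < r}
      ≤ ENNReal.ofReal (4 / (n * ν.real (Set.Ici b))) := by
  set q := ν.real (Set.Ici b) with hq
  set g : ℝ → ℝ := (Set.Ici b).indicator 1 with hg
  have hgm : Measurable g := measurable_one.indicator measurableSet_Ici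
  have hI2 : ∀ i, MemLp (g ∘ X i) 2 μ := fun i =>
    MemLp.of_bound (hgm.comp (hX i)).aestronglyMeasurable 1 (ae_of_all _ fun ω => by
      simp only [hg, Function.comp, Set.indicator_apply, Pi.one_apply]
      split_ifs <;> simp)
  have hEI : ∀ i, ∫ ω, (g ∘ X i) ω ∂μ = q := by
    intro i
    have h1 : ∫ ω, (g ∘ X i) ω ∂μ = ∫ x, g x ∂(μ.map (X i)) :=
      (integral_map (hX i).aemeasurable hgm.aestronglyMeasurable).symm
    rw [h1, hν i, hg, integral_indicator_one measurableSet_Ici]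
  have hVI : ∀ i, Var[g ∘ X i; μ] ≤ q := by
    intro i
    refine (variance_le_expectation_sq (hgm.comp (hX i)).aestronglyMeasurable).trans ?_
    rw [← hEI i]
    refine le_of_eq (integral_congr_ae (ae_of_all _ fun ω => ?_))
    simp only [hg, Function.comp, Set.indicator_apply, Pi.one_apply, Pi.pow_apply]
    split_ifs <;> simp
  set N : Ω → ℝ := ∑ i, g ∘ X i with hN
  have hNcard : ∀ ω, N ω = (Finset.univ.filter fun i => b ≤ X i ω).card := by
    intro ω
    simp [hN, hg, Set.indicator_apply, Finset.sum_boole]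
  have hN2 : MemLp N 2 μ := memLp_finsetSum' _ fun i _ => hI2 i
  have hEN : ∫ ω, N ω ∂μ = n * q := by
    simp only [hN, Finset.sum_apply]
    rw [integral_finsetSum _ fun i _ => (hI2 i).integrable one_le_two,
      Finset.sum_congr rfl fun i _ => hEI i]
    simp
  have hVN : Var[N; μ] ≤ n * q := by
    rw [hN, IndepFun.variance_sum (fun i _ => hI2 i) fun i _ l _ hil =>
      (hind.indepFun hil).comp hgm hgm]
    refine (Finset.sum_le_card_nsmul _ _ q fun i _ => hVI i).trans ?_
    simp
  have hc : 0 < n * q / 2 := by linarith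
  refine (measure_mono fun ω hω => ?_).trans ((meas_ge_le_variance_div_sq hN2 hc).trans
    (ENNReal.ofReal_le_ofReal ?_))
  · simp only [Set.mem_ofPred_eq] at hω ⊢
    rw [hEN, hNcard, le_abs]
    right
    have : ((Finset.univ.filter fun i => b ≤ X i ω).card : ℝ) ≤ r := by exact_mod_cast hω.le
    linarith
  · calc Var[N; μ] / (n * q / 2) ^ 2 ≤ n * q / (n * q / 2) ^ 2 := by gcongr
      _ = 4 / (n * q) := by field_simp; norm_num

lemma measure_exists_le {n : ℕ} {X : Fin n → Ω → ℝ} (hX : ∀ i, Measurable (X i))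
    {ν : Measure ℝ} [IsProbabilityMeasure ν] (hν : ∀ i, μ.map (X i) = ν) (b : ℝ) :
    μ {ω | ∃ i, b ≤ X i ω} ≤ ENNReal.ofReal (n * ν.real (Set.Ici b)) := by
  have : {ω | ∃ i, b ≤ X i ω} = ⋃ i, X i ⁻¹' Set.Ici b := by ext; simp
  rw [this]
  refine (measure_iUnion_fintype_le _ _).trans ?_
  have h1 : ∀ i, μ (X i ⁻¹' Set.Ici b) = ENNReal.ofReal (ν.real (Set.Ici b)) := by
    intro i
    rw [← Measure.map_apply (hX i) measurableSet_Ici, hν, ofReal_measureReal]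
  simp [h1, ENNReal.ofReal_mul]

/-- A triangular array of independent variables with common law `ν`. -/
structure IsIIDArray (μ : Measure Ω) (ν : Measure ℝ) (X : ∀ n, Fin n → Ω → ℝ) : Prop where
  measurable : ∀ n i, Measurable (X n i)
  indep : ∀ n, iIndepFun (X n) μ
  law : ∀ n i, μ.map (X n i) = ν

lemma IsIIDArray.neg {ν : Measure ℝ} {X : ∀ n, Fin n → Ω → ℝ} (h : IsIIDArray μ ν X) :
    IsIIDArray μ (ν.map fun x => -x) fun n i ω => -X n i ω where
  measurable n i := (h.measurable n i).neg
  indep n := (h.indep n).comp (fun _ x => -x) fun _ => measurable_neg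
  law n i := by
    rw [← h.law n i, Measure.map_map measurable_neg (h.measurable n i)]
    rfl

variable {ν : Measure ℝ} {X : ∀ n, Fin n → Ω → ℝ} {r : ℕ → ℕ}

/-- If `r` is negligible compared with the expected number of observations above `b`, then with
high probability at least `r` observations lie there. -/
lemma IsIIDArray.tendsto_card_lt [IsProbabilityMeasure μ] (h : IsIIDArray μ ν X)
    (hr : ∀ᶠ n in atTop, 1 ≤ r n) {b : ℕ → ℝ}
    (hb : ∀ᶠ n in atTop, 0 < ν.real (Set.Ici (b n)))
    (hlim : Tendsto (fun n : ℕ => (r n : ℝ) / (n * ν.real (Set.Ici (b n)))) atTop (𝓝 0)) :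
    Tendsto (fun n => μ {ω | (Finset.univ.filter fun i => b n ≤ X n i ω).card < r n})
      atTop (𝓝 0) := by
  have hup : Tendsto (fun n : ℕ => ENNReal.ofReal (4 * ((r n : ℝ) / (n * ν.real (Set.Ici (b n))))))
      atTop (𝓝 0) := by
    simpa using ENNReal.tendsto_ofReal (hlim.const_mul 4)
  refine tendsto_of_tendsto_of_tendsto_of_le_of_le' tendsto_const_nhds hup
    (Eventually.of_forall fun _ => zero_le) ?_
  filter_upwards [hr, hb, eventually_gt_atTop 0, hlim.eventually_lt_const (show (0 : ℝ) < 1 / 2 by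
    norm_num)] with n h1 h2 h3 h4
  have hpos : 0 < (n : ℝ) * ν.real (Set.Ici (b n)) := mul_pos (by exact_mod_cast h3) h2
  have hr1 : (1 : ℝ) ≤ r n := by exact_mod_cast h1
  rw [div_lt_iff₀ hpos] at h4
  refine (measure_card_lt_le (h.measurable n) (h.indep n) (h.law n) hpos (by linarith)).trans
    (ENNReal.ofReal_le_ofReal ?_)
  rw [← mul_div_assoc]
  gcongr
  linarith

end Counting

/-! ### The range of the data and the range without the extremes -/

section Tail

variable {Ω : Type*} [MeasurableSpace Ω] {μ : Measure Ω}

/-- With high probability all observations are at most `hi n`, at least `r n` of them are at least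
`b n`, and the distances of `hi n` and `b n` to the centre `c` are comparable. The lower tail is
covered by applying this to `-X` and `-c`. -/
def UpperTailComparable (μ : Measure Ω) (X : ∀ n, Fin n → Ω → ℝ) (r : ℕ → ℕ) (c : ℝ) : Prop :=
  ∃ (M : ℝ) (hi b : ℕ → ℝ), 0 < M ∧
    Tendsto (fun n => μ {ω | ∃ i, hi n < X n i ω}) atTop (𝓝 0) ∧
    Tendsto (fun n => μ {ω | (Finset.univ.filter fun i => b n ≤ X n i ω).card < r n})
      atTop (𝓝 0) ∧
    ∀ᶠ n in atTop, c ≤ b n ∧ hi n - c ≤ M * (b n - c)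

variable {ν : Measure ℝ} {X : ∀ n, Fin n → Ω → ℝ} {r : ℕ → ℕ}

lemma IsIIDArray.upperTailComparable_of_bounded [IsProbabilityMeasure μ] (h : IsIIDArray μ ν X)
    (hr : ∀ᶠ n in atTop, 1 ≤ r n) {c b C : ℝ} (hcb : c < b) (hb : 0 < ν.real (Set.Ici b))
    (hC : ν (Set.Ioi C) = 0) (hrn : Tendsto (fun n : ℕ => (r n : ℝ) / n) atTop (𝓝 0)) :
    UpperTailComparable μ X r c := by
  refine ⟨max 1 ((C - c) / (b - c)), fun _ => C, fun _ => b, by positivity, ?_, ?_,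
    Eventually.of_forall fun _ => ⟨hcb.le, ?_⟩⟩
  · refine tendsto_const_nhds.congr fun n => ?_
    have : {ω | ∃ i, C < X n i ω} = ⋃ i, X n i ⁻¹' Set.Ioi C := by ext; simp
    rw [this]
    refine (measure_iUnion_null fun i => ?_).symm
    rw [← Measure.map_apply (h.measurable n i) measurableSet_Ioi, h.law, hC]
  · refine h.tendsto_card_lt hr (Eventually.of_forall fun _ => hb) ?_
    have := hrn.div_const (ν.real (Set.Ici b))
    simpa [div_div] using this
  · have hbc : 0 < b - c := by linarith
    calc C - c = (C - c) / (b - c) * (b - c) := by field_simp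
      _ ≤ _ := by gcongr; exact le_max_right _ _

/-- If few observations are expected beyond `Q n`, but many beyond `Q n / 2`, for quantiles `Q n`
at level `1 - 1 / n`, then the tail decays fast: hardly any observation is expected beyond
`4 * Q n`. The decay follows from the hypothesis at the index `m` for which
`1 / m` is about the probability of exceeding `4 * Q n`, so that `Q m` is at least `4 * Q n`. -/
lemma tendsto_mul_tail [IsProbabilityMeasure ν] {Q : ℕ → ℝ}
    (hQ : ∀ n : ℕ, 1 ≤ n → ∀ x, Q n < x → ν.real (Set.Ici x) ≤ 1 / n)
    (hpos : ∀ x, 0 < ν.real (Set.Ici x)) (hQt : Tendsto Q atTop atTop)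
    (hr : ∀ᶠ n in atTop, 1 ≤ r n)
    (hlim : Tendsto (fun n : ℕ => (r n : ℝ) / (n * ν.real (Set.Ici (Q n / 2)))) atTop (𝓝 0)) :
    Tendsto (fun n : ℕ => (n : ℝ) * ν.real (Set.Ici (4 * Q n))) atTop (𝓝 0) := by
  have hanti : ∀ x y, x ≤ y → ν.real (Set.Ici y) ≤ ν.real (Set.Ici x) := fun x y hxy =>
    measureReal_mono (Set.Ici_subset_Ici.2 hxy)
  rw [Metric.tendsto_atTop']
  intro e he
  have hev : ∀ᶠ m : ℕ in atTop, 1 / (m * ν.real (Set.Ici (Q m / 2))) < e / 2 := by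
    filter_upwards [hr, hlim.eventually_lt_const (show 0 < e / 2 by linarith)] with m h1 h2
    refine lt_of_le_of_lt ?_ h2
    have := hpos (Q m / 2)
    gcongr
    exact_mod_cast h1
  obtain ⟨m₀, hm₀⟩ := eventually_atTop.1 hev
  have hev2 : ∀ᶠ n : ℕ in atTop, |(n : ℝ) * ν.real (Set.Ici (4 * Q n)) - 0| < e := by
    filter_upwards [eventually_ge_atTop (max m₀ 1), hQt.eventually_gt_atTop 0] with n hn hQn
    have hn1 : 1 ≤ n := (le_max_right _ _).trans hn
    have hn0 : (0 : ℝ) < n := by exact_mod_cast hn1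
    set T := ν.real (Set.Ici (4 * Q n)) with hT
    have hT0 : 0 < T := hpos _
    have hTn : T ≤ 1 / n := hQ n hn1 _ (by linarith)
    set m : ℕ := ⌊1 / T⌋₊ + 1 with hm
    have hmT : 1 / T < m := by
      rw [hm]; push_cast; exact Nat.lt_floor_add_one _
    have hmT' : (m : ℝ) ≤ 2 / T := by
      have h1 : (⌊1 / T⌋₊ : ℝ) ≤ 1 / T := Nat.floor_le (by positivity)
      have h2 : 1 ≤ 1 / T := by
        rw [le_div_iff₀ hT0]
        linarith [show T ≤ 1 from measureReal_le_one]
      have h3 : 2 / T = 1 / T + 1 / T := by ring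
      rw [hm, h3]; push_cast; linarith
    have hnm : n ≤ m := by
      have : (n : ℝ) ≤ 1 / T := by
        rw [le_div_iff₀ hT0]
        rw [le_div_iff₀ hn0] at hTn
        linarith
      exact_mod_cast (this.trans hmT.le)
    have hm0 : (0 : ℝ) < m := by exact_mod_cast hn1.trans hnm
    have hQm : 4 * Q n ≤ Q m := by
      by_contra hlt
      have := hQ m (hn1.trans hnm) _ (not_le.1 hlt)
      rw [le_div_iff₀ hm0] at this
      rw [div_lt_iff₀ hT0] at hmT
      linarith
    have hTm : ν.real (Set.Ici (Q m / 2)) ≤ 1 / n := hQ n hn1 _ (by linarith)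
    have h5 := hm₀ m ((le_max_left _ _).trans (hn.trans hnm))
    have h6 : (n : ℝ) / m ≤ 1 / (m * ν.real (Set.Ici (Q m / 2))) := by
      have := hpos (Q m / 2)
      rw [div_le_div_iff₀ hm0 (by positivity)]
      rw [le_div_iff₀ hn0] at hTm
      nlinarith
    have h7 : (n : ℝ) * T / 2 ≤ n / m := by
      rw [le_div_iff₀ hT0] at hmT'
      rw [div_le_div_iff₀ (by norm_num) hm0]
      nlinarith
    rw [sub_zero, abs_of_nonneg (by positivity)]
    linarith
  obtain ⟨n₀, hn₀⟩ := eventually_atTop.1 hev2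
  exact ⟨n₀, fun n hn => by simpa [Real.dist_eq] using hn₀ n hn.le⟩

lemma IsIIDArray.upperTailComparable_of_quantile [IsProbabilityMeasure μ]
    [IsProbabilityMeasure ν] (h : IsIIDArray μ ν X)
    (hr : ∀ᶠ n in atTop, 1 ≤ r n) (c : ℝ) {Q : ℕ → ℝ}
    (hQ : ∀ n : ℕ, 1 ≤ n → ∀ x, Q n < x → ν.real (Set.Ici x) ≤ 1 / n)
    (hpos : ∀ x, 0 < ν.real (Set.Ici x))
    (hlim : Tendsto (fun n : ℕ => (r n : ℝ) / (n * ν.real (Set.Ici (Q n / 2)))) atTop (𝓝 0)) :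
    UpperTailComparable μ X r c := by
  have hQt : Tendsto Q atTop atTop := by
    rw [tendsto_atTop]
    intro s
    filter_upwards [tendsto_one_div_atTop_nhds_zero_nat.eventually_lt_const (hpos s),
      eventually_ge_atTop 1] with n h1 h2
    by_contra hlt
    exact absurd (hQ n h2 s (not_le.1 hlt)) (not_le.2 h1)
  refine ⟨16, fun n => 4 * Q n, fun n => Q n / 2, by norm_num, ?_,
    h.tendsto_card_lt hr (Eventually.of_forall fun n => hpos _) hlim, ?_⟩
  · have h0 : Tendsto (fun n : ℕ => ENNReal.ofReal (n * ν.real (Set.Ici (4 * Q n)))) atTop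
        (𝓝 0) := by
      simpa using ENNReal.tendsto_ofReal (tendsto_mul_tail hQ hpos hQt hr hlim)
    refine tendsto_of_tendsto_of_tendsto_of_le_of_le tendsto_const_nhds h0 (fun _ => zero_le)
      fun n => ?_
    refine (measure_mono fun ω hω => ?_).trans (measure_exists_le (h.measurable n) (h.law n) _)
    obtain ⟨i, hi⟩ := hω
    exact ⟨i, hi.le⟩
  · filter_upwards [hQt.eventually_ge_atTop (4 * |c|)] with n hn
    have h1 := le_abs_self c
    have h2 := neg_abs_le c
    exact ⟨by linarith, by linarith⟩

/-- If both tails are under control, then the range of the data is of the same order as the range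
of the data without the `r - 1` most extreme observations on either side. -/
lemma tendsto_range_of_upperTailComparable {c : ℝ} (hr : ∀ᶠ n in atTop, 1 ≤ r n ∧ 2 * r n ≤ n)
    (hup : UpperTailComparable μ X r c)
    (hlow : UpperTailComparable μ (fun n i ω => -X n i ω) r (-c)) :
    ∃ M : ℝ, 0 < M ∧ Tendsto (fun n => μ {ω |
      M * (orderStat (fun i => X n i ω) (n - r n + 1) - orderStat (fun i => X n i ω) (r n))
        < orderStat (fun i => X n i ω) n - orderStat (fun i => X n i ω) 1}) atTop (𝓝 0) := by
  obtain ⟨M₁, hi, b, hM₁, hhi, hb, hev₁⟩ := hup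
  obtain ⟨M₂, lo, a, hM₂, hlo, ha, hev₂⟩ := hlow
  refine ⟨max M₁ M₂, lt_max_of_lt_left hM₁, ?_⟩
  have hsum := ((hhi.add hb).add (hlo.add ha))
  simp only [add_zero] at hsum
  refine tendsto_of_tendsto_of_tendsto_of_le_of_le' tendsto_const_nhds hsum
    (Eventually.of_forall fun _ => zero_le) ?_
  filter_upwards [hr, hev₁, hev₂] with n ⟨hr1, hrn⟩ ⟨hcb, hcM⟩ ⟨hca, hcM'⟩
  refine (measure_mono ?_).trans ((measure_union_le _ _).trans
    (add_le_add (measure_union_le _ _) (measure_union_le _ _)))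
  intro ω hω
  by_contra hgood
  simp only [Set.mem_union, Set.mem_ofPred_eq, not_or, not_exists, not_lt] at hgood hω
  obtain ⟨⟨g1, g2⟩, g3, g4⟩ := hgood
  set x : Fin n → ℝ := fun i => X n i ω with hx
  have e1 : orderStat x n ≤ hi n := orderStat_le x (by omega) (by
    rw [Finset.filter_true_of_mem fun i _ => g1 i]; simp)
  have e2 : b n ≤ orderStat x (n - r n + 1) := le_orderStat_of_le_card x hr1 (by omega) g2
  have e3 : -lo n ≤ orderStat x 1 := le_orderStat x le_rfl (by omega) (by
    rw [Finset.filter_false_of_mem fun i _ => not_lt.2 (by linarith [g3 i])]; simp)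
  have e4 : orderStat x (r n) ≤ -a n := orderStat_le x hr1 (g4.trans (Finset.card_le_card
    fun i hi => by
      simp only [Finset.mem_filter, Finset.mem_univ, true_and] at hi ⊢
      linarith))
  have k1 : M₁ * (b n - c) ≤ max M₁ M₂ * (b n - c) :=
    mul_le_mul_of_nonneg_right (le_max_left _ _) (by linarith)
  have k2 : M₂ * (a n - -c) ≤ max M₁ M₂ * (a n - -c) :=
    mul_le_mul_of_nonneg_right (le_max_right _ _) (by linarith)
  have k3 : max M₁ M₂ * (b n + a n) ≤ max M₁ M₂ * (orderStat x (n - r n + 1) - orderStat x (r n)) :=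
    mul_le_mul_of_nonneg_left (by linarith) (hM₁.le.trans (le_max_left _ _))
  have k4 : max M₁ M₂ * (b n + a n) = max M₁ M₂ * (b n - c) + max M₁ M₂ * (a n - -c) := by ring
  linarith

end Tail

/-! ### Tail conditions in terms of the distribution function -/

section TailConditions

variable {ν : Measure ℝ}

lemma measureReal_Ioi_eq_one_sub_cdf [IsProbabilityMeasure ν] (x : ℝ) :
    ν.real (Set.Ioi x) = 1 - cdf ν x := by
  rw [cdf_eq_real, ← Set.compl_Iic, probReal_compl_eq_one_sub measurableSet_Iic]

lemma measureReal_map_neg_Ici [IsProbabilityMeasure ν] (x : ℝ) :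
    (ν.map fun x => -x).real (Set.Ici x) = cdf ν (-x) := by
  rw [cdf_eq_real, map_measureReal_apply measurable_neg measurableSet_Ici]
  congr 1
  ext y
  simp

lemma cdf_lt_one_of_upperEndpoint_eq_top (h : upperEndpoint ν = ⊤) (x : ℝ) : cdf ν x < 1 := by
  have hx : (x : EReal) < upperEndpoint ν := h ▸ EReal.coe_lt_top x
  obtain ⟨_, ⟨y, hy, rfl⟩, hxy⟩ := lt_sSup_iff.1 hx
  exact ((cdf ν).mono (EReal.coe_lt_coe_iff.1 hxy).le).trans_lt hy

lemma cdf_pos_of_lowerEndpoint_eq_bot (h : lowerEndpoint ν = ⊥) (x : ℝ) : 0 < cdf ν x := by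
  have hx : lowerEndpoint ν < (x : EReal) := h ▸ EReal.bot_lt_coe x
  obtain ⟨_, ⟨y, hy, rfl⟩, hxy⟩ := sInf_lt_iff.1 hx
  exact lt_of_lt_of_le hy ((cdf ν).mono (EReal.coe_lt_coe_iff.1 hxy).le)

lemma exists_cdf_eq_one_of_upperEndpoint_ne_top (h : upperEndpoint ν ≠ ⊤) :
    ∃ C, cdf ν C = 1 := by
  by_contra! hC
  refine h ((EReal.eq_top_iff_forall_lt _).2 fun x => ?_)
  refine (EReal.coe_lt_coe_iff.2 (lt_add_one x)).trans_le (le_sSup ⟨x + 1, ?_, rfl⟩)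
  exact lt_of_le_of_ne (cdf_le_one ν _) (hC _)

lemma exists_cdf_eq_zero_of_lowerEndpoint_ne_bot (h : lowerEndpoint ν ≠ ⊥) :
    ∃ C, cdf ν C = 0 := by
  by_contra! hC
  refine h ((EReal.eq_bot_iff_forall_lt _).2 fun x => ?_)
  refine (sInf_le ⟨x - 1, ?_, rfl⟩ : lowerEndpoint ν ≤ _).trans_lt
    (EReal.coe_lt_coe_iff.2 (sub_one_lt x))
  exact lt_of_le_of_ne (cdf_nonneg ν _) (hC _).symm

lemma measureReal_Ici_le_of_quantile_lt [IsProbabilityMeasure ν] {n : ℕ} (hn : 1 ≤ n)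
    {x : ℝ} (hx : quantile ν (1 - (n : ℝ)⁻¹) < x) : ν.real (Set.Ici x) ≤ 1 / n := by
  have hn0 : (0 : ℝ) < n := by exact_mod_cast hn
  have hq : 1 - (n : ℝ)⁻¹ < 1 := by linarith [inv_pos.2 hn0]
  have hne : {x : ℝ | 1 - (n : ℝ)⁻¹ ≤ cdf ν x}.Nonempty := by
    obtain ⟨y, hy⟩ := ((tendsto_cdf_atTop ν).eventually_const_lt hq).exists
    exact ⟨y, hy.le⟩
  obtain ⟨y, hy, hyx⟩ := exists_lt_of_csInf_lt hne hx
  have hy' : 1 - (n : ℝ)⁻¹ ≤ cdf ν y := hy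
  calc ν.real (Set.Ici x) ≤ ν.real (Set.Ioi y) := measureReal_mono fun t ht => hyx.trans_le ht
    _ = 1 - cdf ν y := measureReal_Ioi_eq_one_sub_cdf y
    _ ≤ 1 / n := by rw [one_div]; linarith

lemma cdf_le_of_lt_quantile {n : ℕ} (hn : 1 ≤ n) {x : ℝ} (hx : x < quantile ν (n : ℝ)⁻¹) :
    cdf ν x ≤ 1 / n := by
  have hn0 : (0 : ℝ) < (n : ℝ)⁻¹ := inv_pos.2 (by exact_mod_cast hn)
  have hbdd : BddBelow {x : ℝ | (n : ℝ)⁻¹ ≤ cdf ν x} := by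
    obtain ⟨y, hy⟩ := ((tendsto_cdf_atBot ν).eventually_lt_const hn0).exists
    refine ⟨y, fun t ht => ?_⟩
    by_contra hlt
    exact absurd ((cdf ν).mono (not_le.1 hlt).le) (not_le.2 (hy.trans_le ht))
  have := notMem_of_lt_csInf hx hbdd
  rw [one_div]
  exact (not_le.1 this).le

/-- A law in a domain of attraction is not degenerate. -/
lemma InMaxDomain.exists_cdf_pos_lt_one (h : InMaxDomain ν) :
    ∃ s t, s < t ∧ 0 < cdf ν s ∧ cdf ν t < 1 := by
  obtain ⟨ξ, a, b, -, hlim⟩ := h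
  have h0 : gevCDF ξ 0 = Real.exp (-1) := by
    by_cases hξ : ξ = 0 <;> simp [gevCDF, hξ]
  have hl := hlim 0
  rw [h0] at hl
  obtain ⟨n, h1, h2, hn⟩ := ((hl.eventually_const_lt (Real.exp_pos _)).and
    ((hl.eventually_lt_const (show Real.exp (-1) < 1 by simp)).and
      (eventually_ne_atTop 0))).exists
  set s := a n * 0 + b n
  have hs0 : 0 < cdf ν s := by
    refine lt_of_le_of_ne (cdf_nonneg ν s) fun h => ?_
    rw [← h, zero_pow hn] at h1
    exact lt_irrefl _ h1
  have hs1 : cdf ν s < 1 := by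
    refine lt_of_le_of_ne (cdf_le_one ν s) fun h => ?_
    rw [h, one_pow] at h2
    exact lt_irrefl _ h2
  have hright : Tendsto (cdf ν) (𝓝[>] s) (𝓝 (cdf ν s)) :=
    ((cdf ν).right_continuous s).mono_left (nhdsWithin_mono _ Set.Ioi_subset_Ici_self)
  obtain ⟨t, ht, hst⟩ := ((hright.eventually_lt_const hs1).and self_mem_nhdsWithin).exists
  exact ⟨s, t, hst, hs0, ht⟩

lemma tendsto_ratio_of_le {r : ℕ → ℕ} {u v : ℕ → ℝ} (hu : ∀ n, 0 < u n) (huv : ∀ n, u n ≤ v n)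
    (h : Tendsto (fun n : ℕ => (r n : ℝ) / (n * u n)) atTop (𝓝 0)) :
    Tendsto (fun n : ℕ => (r n : ℝ) / (n * v n)) atTop (𝓝 0) := by
  refine squeeze_zero' (Eventually.of_forall fun n => ?_) ?_ h
  · have := (hu n).le.trans (huv n)
    positivity
  · filter_upwards [eventually_gt_atTop 0] with n hn
    have hn0 : (0 : ℝ) < n := by exact_mod_cast hn
    have := hu n
    have := huv n
    gcongr

lemma UpperTailCondition.tendsto_div {r : ℕ → ℕ} (h : UpperTailCondition ν r)
    (hν : upperEndpoint ν = ⊤) : Tendsto (fun n : ℕ => (r n : ℝ) / n) atTop (𝓝 0) := by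
  have := tendsto_ratio_of_le (v := fun _ => 1)
    (fun n => sub_pos.2 (cdf_lt_one_of_upperEndpoint_eq_top hν _))
    (fun n => by linarith [cdf_nonneg ν ((1 - 1) * quantile ν (1 - (n : ℝ)⁻¹))]) (h 1 one_pos)
  simpa using this

lemma LowerTailCondition.tendsto_div {r : ℕ → ℕ} (h : LowerTailCondition ν r)
    (hν : lowerEndpoint ν = ⊥) : Tendsto (fun n : ℕ => (r n : ℝ) / n) atTop (𝓝 0) := by
  have := tendsto_ratio_of_le (v := fun _ => 1) (fun n => cdf_pos_of_lowerEndpoint_eq_bot hν _)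
    (fun n => cdf_le_one ν _) (h 1 one_pos)
  simpa using this

/-- Unless `r` is eventually constant, each of the range conditions makes `r / n` vanish and
contains the tail condition for every infinite endpoint. -/
lemma RangeCondition.cases {r : ℕ → ℕ} (h : RangeCondition ν r) :
    (∃ r₀ : ℕ, ∀ᶠ n in atTop, r n = r₀) ∨
    (Tendsto (fun n : ℕ => (r n : ℝ) / n) atTop (𝓝 0) ∧
      (upperEndpoint ν = ⊤ → UpperTailCondition ν r) ∧
      (lowerEndpoint ν = ⊥ → LowerTailCondition ν r)) := by
  rcases h with h | ⟨h1, h2, -, h⟩ | ⟨h1, h2, -, h⟩ | ⟨h1, h2, -, h⟩ | ⟨h1, h2, h, h'⟩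
  · exact Or.inl h
  · exact Or.inr ⟨h, fun h' => absurd h' h1, fun h' => absurd h' h2⟩
  · exact Or.inr ⟨h.tendsto_div h1, fun _ => h, fun h' => absurd h' h2⟩
  · exact Or.inr ⟨h.tendsto_div h2, fun h' => absurd h' h1, fun _ => h⟩
  · exact Or.inr ⟨h.tendsto_div h1, fun _ => h, fun _ => h'⟩

variable {Ω : Type*} [MeasurableSpace Ω] {μ : Measure Ω} [IsProbabilityMeasure μ]
  [IsProbabilityMeasure ν] {X : ∀ n, Fin n → Ω → ℝ} {r : ℕ → ℕ}

lemma IsIIDArray.upperTailComparable (h : IsIIDArray μ ν X) (hr : ∀ᶠ n in atTop, 1 ≤ r n)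
    {c t : ℝ} (hct : c < t) (ht : cdf ν t < 1)
    (hrn : Tendsto (fun n : ℕ => (r n : ℝ) / n) atTop (𝓝 0))
    (hν : upperEndpoint ν = ⊤ → UpperTailCondition ν r) : UpperTailComparable μ X r c := by
  have hIoi : ∀ x, 1 - cdf ν x ≤ ν.real (Set.Ici x) := fun x => by
    rw [← measureReal_Ioi_eq_one_sub_cdf]
    exact measureReal_mono Set.Ioi_subset_Ici_self
  by_cases htop : upperEndpoint ν = ⊤
  · have hlt := cdf_lt_one_of_upperEndpoint_eq_top htop
    refine h.upperTailComparable_of_quantile hr c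
      (fun n hn x hx => measureReal_Ici_le_of_quantile_lt hn hx)
      (fun x => (sub_pos.2 (hlt x)).trans_le (hIoi x)) ?_
    refine tendsto_ratio_of_le (fun n => sub_pos.2 (hlt _)) (fun n => ?_)
      (hν htop (1 / 2) (by norm_num))
    rw [show (1 - 1 / 2 : ℝ) * quantile ν (1 - (n : ℝ)⁻¹) = quantile ν (1 - (n : ℝ)⁻¹) / 2 by ring]
    exact hIoi _
  · obtain ⟨C, hC⟩ := exists_cdf_eq_one_of_upperEndpoint_ne_top htop
    refine h.upperTailComparable_of_bounded hr hct ((sub_pos.2 ht).trans_le (hIoi t)) (C := C) ?_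
      hrn
    rw [← measureReal_eq_zero_iff, measureReal_Ioi_eq_one_sub_cdf, hC, sub_self]

lemma IsIIDArray.upperTailComparable_neg (h : IsIIDArray μ ν X) (hr : ∀ᶠ n in atTop, 1 ≤ r n)
    {c s : ℝ} (hsc : s < c) (hs : 0 < cdf ν s)
    (hrn : Tendsto (fun n : ℕ => (r n : ℝ) / n) atTop (𝓝 0))
    (hν : lowerEndpoint ν = ⊥ → LowerTailCondition ν r) :
    UpperTailComparable μ (fun n i ω => -X n i ω) r (-c) := by
  have : IsProbabilityMeasure (ν.map fun x => -x) :=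
    Measure.isProbabilityMeasure_map measurable_neg.aemeasurable
  by_cases hbot : lowerEndpoint ν = ⊥
  · have hpos := cdf_pos_of_lowerEndpoint_eq_bot hbot
    refine h.neg.upperTailComparable_of_quantile hr (-c) (Q := fun n => -quantile ν (n : ℝ)⁻¹)
      (fun n hn x hx => ?_) (fun x => ?_) ?_
    · rw [measureReal_map_neg_Ici]
      exact cdf_le_of_lt_quantile hn (by linarith)
    · rw [measureReal_map_neg_Ici]
      exact hpos _
    · refine (hν hbot (1 / 2) (by norm_num)).congr fun n => ?_
      rw [measureReal_map_neg_Ici]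
      congr 4
      ring
  · obtain ⟨C, hC⟩ := exists_cdf_eq_zero_of_lowerEndpoint_ne_bot hbot
    refine h.neg.upperTailComparable_of_bounded hr (b := -s) (by linarith) ?_ (C := -C) ?_ hrn
    · rwa [measureReal_map_neg_Ici, neg_neg]
    · rw [← measureReal_eq_zero_iff]
      refine le_antisymm ((measureReal_mono Set.Ioi_subset_Ici_self).trans ?_) measureReal_nonneg
      rw [measureReal_map_neg_Ici, neg_neg, hC]

lemma IsIIDArray.tendsto_range (h : IsIIDArray μ ν X)
    (hr : ∀ᶠ n in atTop, 1 ≤ r n ∧ 2 * r n ≤ n) (hDA : InMaxDomain ν)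
    (hrn : Tendsto (fun n : ℕ => (r n : ℝ) / n) atTop (𝓝 0))
    (hup : upperEndpoint ν = ⊤ → UpperTailCondition ν r)
    (hlow : lowerEndpoint ν = ⊥ → LowerTailCondition ν r) :
    ∃ M : ℝ, 0 < M ∧ Tendsto (fun n => μ {ω |
      M * (orderStat (fun i => X n i ω) (n - r n + 1) - orderStat (fun i => X n i ω) (r n))
        < orderStat (fun i => X n i ω) n - orderStat (fun i => X n i ω) 1}) atTop (𝓝 0) := by
  obtain ⟨s, t, hst, hs, ht⟩ := hDA.exists_cdf_pos_lt_one
  have hr1 := hr.mono fun n hn => hn.1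
  exact tendsto_range_of_upperTailComparable (c := (s + t) / 2) hr
    (h.upperTailComparable hr1 (by linarith) ht hrn hup)
    (h.upperTailComparable_neg hr1 (by linarith) hs hrn hlow)

end TailConditions

/-! ### The event on which the correlation matrix is well conditioned -/

lemma CorrBoundedBelow.mono {m : Type*} [Fintype m] {p : ℕ} {c c' : ℝ} {z : m → Fin p → ℝ}
    (h : CorrBoundedBelow c z) (hc : c' ≤ c) : CorrBoundedBelow c' z := fun x =>
  (mul_le_mul_of_nonneg_right hc (Finset.sum_nonneg fun _ _ => sq_nonneg _)).trans (h x)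

lemma measurableSet_corrBoundedBelow {m : Type*} [Fintype m] {p : ℕ} (c : ℝ) :
    MeasurableSet {z : m → Fin p → ℝ | CorrBoundedBelow c z} := by
  -- by continuity the inequality need only be tested on a countable dense set
  set d := TopologicalSpace.denseSeq (Fin p → ℝ) with hd
  have heq : {z : m → Fin p → ℝ | CorrBoundedBelow c z} = ⋂ k : ℕ, {z | c * ∑ l, d k l ^ 2
      ≤ ∑ l, ∑ q, d k l * sampleCorr z l q * d k q} := by
    ext z
    simp only [Set.mem_ofPred_eq, Set.mem_iInter]
    refine ⟨fun h k => h (d k), fun h x => ?_⟩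
    refine (TopologicalSpace.denseRange_denseSeq (Fin p → ℝ)).induction_on
      (p := fun x => c * ∑ l, x l ^ 2 ≤ ∑ l, ∑ q, x l * sampleCorr z l q * x q) x ?_ h
    exact isClosed_le (by fun_prop) (by fun_prop)
  rw [heq]
  have hz : ∀ (i : m) (j : Fin p), Measurable fun z : m → Fin p → ℝ => z i j := fun i j =>
    (measurable_pi_apply j).comp (measurable_pi_apply i)
  have hmean : ∀ j : Fin p, Measurable fun z : m → Fin p → ℝ => sampleMean z j := fun j =>
    (Finset.measurable_fun_sum _ fun i _ => hz i j).div_const _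
  have hcov : ∀ j l : Fin p, Measurable fun z : m → Fin p → ℝ => sampleCov z j l := fun j l =>
    (Finset.measurable_fun_sum _ fun i _ =>
      ((hz i j).sub (hmean j)).mul ((hz i l).sub (hmean l))).div_const _
  have hcorr : ∀ j l : Fin p, Measurable fun z : m → Fin p → ℝ => sampleCorr z j l := fun j l =>
    (hcov j l).div ((hcov j j).sqrt.mul (hcov l l).sqrt)
  exact MeasurableSet.iInter fun k => measurableSet_le measurable_const
    (Finset.measurable_fun_sum _ fun l _ => Finset.measurable_fun_sum _ fun q _ =>
      ((hcorr l q).const_mul _).mul_const _)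

lemma measurableSet_corrBoundedBelow_sel {n p : ℕ} {sel : (Fin n → Fin p → ℝ) → Finset (Fin n)}
    (hsel : ∀ S, MeasurableSet {z | sel z = S}) (c : ℝ) :
    MeasurableSet {z | CorrBoundedBelow c (restrictRows (sel z) z)} := by
  have : {z | CorrBoundedBelow c (restrictRows (sel z) z)}
      = ⋃ S, {z | sel z = S} ∩ {z | CorrBoundedBelow c (restrictRows S z)} := by
    ext z
    simp
  rw [this]
  refine MeasurableSet.iUnion fun S => (hsel S).inter ?_
  have hr : Measurable fun z : Fin n → Fin p → ℝ => restrictRows S z :=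
    measurable_pi_lambda _ fun i => measurable_pi_apply _
  exact hr (measurableSet_corrBoundedBelow c)

/-- If almost surely some bound `c > 0` is eventually valid, then with probability close to one a
common `c` is valid for all large `n`. -/
lemma exists_uniform_bound {Ω : Type*} [MeasurableSpace Ω] {μ : Measure Ω} [IsProbabilityMeasure μ]
    {P : ℕ → ℝ → Ω → Prop} (hm : ∀ n c, MeasurableSet {ω | P n c ω})
    (hmono : ∀ n c c' ω, c' ≤ c → P n c ω → P n c' ω)
    (hae : ∀ᵐ ω ∂μ, ∃ c : ℝ, 0 < c ∧ ∀ᶠ n in atTop, P n c ω) {δ : ℝ} (hδ : 0 < δ) :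
    ∃ c : ℝ, 0 < c ∧ ∀ᶠ n in atTop, μ {ω | ¬ P n c ω} ≤ ENNReal.ofReal δ := by
  set B : ℕ → Set Ω := fun N => {ω | ∀ n, N ≤ n → P n (1 / ((N : ℝ) + 1)) ω}ᶜ with hB
  have hBm : ∀ N, MeasurableSet (B N) := fun N => by
    refine MeasurableSet.compl ?_
    have : {ω | ∀ n, N ≤ n → P n (1 / ((N : ℝ) + 1)) ω}
        = ⋂ n, ⋂ (_ : N ≤ n), {ω | P n (1 / ((N : ℝ) + 1)) ω} := by
      ext; simp
    rw [this]
    exact MeasurableSet.iInter fun n => MeasurableSet.iInter fun _ => hm n _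
  have hBanti : Antitone B := fun N N' hN => by
    refine Set.compl_subset_compl.2 fun ω hω n hn => ?_
    refine hmono n _ _ ω ?_ (hω n (hN.trans hn))
    have : (N : ℝ) ≤ N' := by exact_mod_cast hN
    gcongr
  have hnull : μ (⋂ N, B N) = 0 := by
    rw [measure_eq_zero_iff_ae_notMem]
    filter_upwards [hae] with ω hω hmem
    obtain ⟨c, hc, hev⟩ := hω
    obtain ⟨N₀, hN₀⟩ := eventually_atTop.1 hev
    obtain ⟨N₁, hN₁⟩ := exists_nat_one_div_lt hc
    refine Set.mem_iInter.1 hmem (max N₀ N₁) fun n hn => ?_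
    refine hmono n _ _ ω (le_trans ?_ hN₁.le) (hN₀ n ((le_max_left _ _).trans hn))
    have : (N₁ : ℝ) ≤ (max N₀ N₁ : ℕ) := by exact_mod_cast le_max_right _ _
    gcongr
  have hlim := tendsto_measure_iInter_atTop (μ := μ) (fun N => (hBm N).nullMeasurableSet) hBanti
    ⟨0, measure_ne_top _ _⟩
  rw [hnull] at hlim
  obtain ⟨N, hN⟩ := (hlim.eventually_lt_const (ENNReal.ofReal_pos.2 hδ)).exists
  refine ⟨1 / ((N : ℝ) + 1), by positivity, ?_⟩
  filter_upwards [eventually_ge_atTop N] with n hn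
  refine (measure_mono fun ω hω => ?_).trans hN.le
  exact fun hall => hω (hall n hn)

/-! ### The rates -/

lemma rateOf_zero {p r : ℕ} (hp : 1 ≤ p) : rateOf p r 0 = ⊤ := by
  have : (p : ℝ≥0∞) ≠ 0 := by exact_mod_cast (by omega : p ≠ 0)
  simp [rateOf, ENNReal.div_zero this]

lemma rateOf_of_ne_zero {p r : ℕ} (hp : 1 ≤ p) (hr : 1 ≤ r) {d : ℝ} (hd : d ≠ 0) :
    rateOf p r d = ENNReal.ofReal (1 / (2 * r * d ^ 2)) := by
  have hp0 : (0 : ℝ) < p := by exact_mod_cast hp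
  have hr0 : (0 : ℝ) < r := by exact_mod_cast hr
  have hd0 : 0 < d ^ 2 := by positivity
  rw [rateOf, ← ENNReal.ofReal_natCast p, ← ENNReal.ofReal_natCast (2 * p * r),
    ← ENNReal.ofReal_mul (by positivity), ← ENNReal.ofReal_div_of_pos (by push_cast; positivity)]
  congr 1
  push_cast
  field_simp

lemma le_rateOf {p r : ℕ} (hp : 1 ≤ p) (hr : 1 ≤ r) {d v C : ℝ} (hC : 0 < C)
    (h : d ≠ 0 → v ≤ C * (1 / (2 * r * d ^ 2))) :
    ENNReal.ofReal v ≤ ENNReal.ofReal C * rateOf p r d := by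
  by_cases hd : d = 0
  · rw [hd, rateOf_zero hp, ENNReal.mul_top (ENNReal.ofReal_pos.2 hC).ne']
    exact le_top
  · rw [rateOf_of_ne_zero hp hr hd, ← ENNReal.ofReal_mul hC.le]
    exact ENNReal.ofReal_le_ofReal (h hd)

lemma rateOf_le_of_le_mul {p r : ℕ} (hp : 1 ≤ p) (hr : 1 ≤ r) {d R M : ℝ} (hM : 0 < M)
    (hR : 0 ≤ R) (h : R ≤ M * d) :
    rateOf p r d ≤ ENNReal.ofReal (M ^ 2) * rateOf p r R := by
  rcases hR.eq_or_lt with rfl | hR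
  · rw [rateOf_zero hp, ENNReal.mul_top (ENNReal.ofReal_pos.2 (by positivity)).ne']
    exact le_top
  · have hd : 0 < d := pos_of_mul_pos_right (hR.trans_le h) hM.le
    have hr0 : (0 : ℝ) < r := by exact_mod_cast hr
    rw [rateOf_of_ne_zero hp hr hd.ne']
    refine le_rateOf hp hr (by positivity) fun _ => ?_
    have h2 : R ^ 2 ≤ M ^ 2 * d ^ 2 := by
      rw [← mul_pow]
      exact pow_le_pow_left₀ hR.le h 2
    rw [mul_one_div, div_le_div_iff₀ (by positivity) (by positivity)]
    nlinarith

lemma rateOf_one_le {p r : ℕ} (hp : 1 ≤ p) (hr : 1 ≤ r) (d : ℝ) :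
    rateOf p 1 d ≤ ENNReal.ofReal (r + 1) * rateOf p r d := by
  by_cases hd : d = 0
  · rw [hd, rateOf_zero hp, rateOf_zero hp,
      ENNReal.mul_top (ENNReal.ofReal_pos.2 (by positivity)).ne']
  · have hr0 : (0 : ℝ) < r := by exact_mod_cast hr
    rw [rateOf_of_ne_zero hp le_rfl hd]
    refine le_rateOf hp hr (by positivity) fun _ => ?_
    rw [mul_one_div, div_le_div_iff₀ (by positivity) (by positivity)]
    have := sq_nonneg d
    push_cast
    nlinarith

section Bounds

variable {n p r : ℕ} {z : Fin n → Fin p → ℝ} {S : Finset (Fin n)} {c σ : ℝ}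

/-- Upper bound of the slope variance by a spread of the covariate in the full data; `m = r` gives
the general rate and `m = 1` the rate in terms of the range. -/
lemma ofReal_var_le (hc : 0 < c) (hσ : 0 < σ) (hS : IsIBOSSSubset r z S)
    (h : CorrBoundedBelow c (restrictRows S z)) (j : Fin p) {m : ℕ} (h1 : 1 ≤ m) (hm : m ≤ r)
    (hn : 2 * m ≤ n) :
    ENNReal.ofReal (σ ^ 2 * (gramMatrix (restrictRows S z))⁻¹ j.succ j.succ)
      ≤ ENNReal.ofReal (8 * σ ^ 2 / c) * rateOf p m
        (orderStat (fun i => z i j) (n - m + 1) - orderStat (fun i => z i j) m) := by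
  have hp : 1 ≤ p := lt_of_le_of_lt (Nat.zero_le _) j.2
  refine le_rateOf hp h1 (by positivity) fun hd => ?_
  have hm0 : (0 : ℝ) < m := by exact_mod_cast h1
  set d := orderStat (fun i => z i j) (n - m + 1) - orderStat (fun i => z i j) m
  have hss : m * d ^ 2 / 4 ≤ centredSS (restrictRows S z) j := hS.le_centredSS j h1 hm hn
  calc σ ^ 2 * (gramMatrix (restrictRows S z))⁻¹ j.succ j.succ
      ≤ σ ^ 2 * (1 / (c * centredSS (restrictRows S z) j)) := by
        gcongr
        exact h.inv_gram_le hc j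
    _ ≤ σ ^ 2 * (1 / (c * (m * d ^ 2 / 4))) := by gcongr
    _ = 8 * σ ^ 2 / c * (1 / (2 * m * d ^ 2)) := by field_simp; norm_num

lemma rateOf_range_le (hc : 0 < c) (hσ : 0 < σ) (hr : 1 ≤ r) (hS : IsIBOSSSubset r z S)
    (h : CorrBoundedBelow c (restrictRows S z)) (j : Fin p) :
    rateOf p r (orderStat (fun i => z i j) n - orderStat (fun i => z i j) 1)
      ≤ ENNReal.ofReal (p / σ ^ 2)
        * ENNReal.ofReal (σ ^ 2 * (gramMatrix (restrictRows S z))⁻¹ j.succ j.succ) := by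
  have : Nonempty (Fin p) := ⟨j⟩
  have hp : 1 ≤ p := lt_of_le_of_lt (Nat.zero_le _) j.2
  have hp0 : (0 : ℝ) < p := by exact_mod_cast hp
  have hr0 : (0 : ℝ) < r := by exact_mod_cast hr
  set R := orderStat (fun i => z i j) n - orderStat (fun i => z i j) 1 with hR
  have hpos := h.centredSS_pos hc j
  have hle : centredSS (restrictRows S z) j ≤ (2 * p * r : ℕ) * R ^ 2 := hS.centredSS_le j
  push_cast at hle
  have hR0 : R ≠ 0 := fun h0 => by
    rw [h0] at hle
    norm_num at hle
    linarith
  rw [rateOf_of_ne_zero hp hr hR0, ← ENNReal.ofReal_mul (by positivity)]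
  refine ENNReal.ofReal_le_ofReal ?_
  calc 1 / (2 * r * R ^ 2) = p * (1 / (2 * p * r * R ^ 2)) := by field_simp
    _ ≤ p * (1 / centredSS (restrictRows S z) j) := by gcongr
    _ ≤ p * (gramMatrix (restrictRows S z))⁻¹ j.succ j.succ := by
        gcongr
        exact inv_centredSS_le_inv_gram (h.isUnit_gram hc) j hpos
    _ = _ := by field_simp

end Bounds

/-! ### Orders in probability of the slope variances -/

/-- `A n = O_P(B n)` follows from bounds that hold outside sets of small outer measure, so no
measurability of `A n` and `B n` is needed. -/
lemma isBigOP_of_forall_exists {Ω : Type*} [MeasurableSpace Ω] {μ : Measure Ω}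
    {A B : ℕ → Ω → ℝ≥0∞} (h : ∀ δ : ℝ, 0 < δ → ∃ M : ℝ, 0 < M ∧ ∀ᶠ n in atTop, ∃ bad : Set Ω,
      μ bad ≤ ENNReal.ofReal δ ∧ ∀ᵐ ω ∂μ, ω ∉ bad → A n ω ≤ ENNReal.ofReal M * B n ω) :
    IsBigOP μ A B := by
  intro δ hδ
  obtain ⟨M, hM, hev⟩ := h δ hδ
  refine ⟨M, hM, hev.mono fun n hn => ?_⟩
  obtain ⟨bad, hbad, hae⟩ := hn
  refine (measure_mono_ae ?_).trans hbad
  filter_upwards [hae] with ω hω hlt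
  by_contra hnot
  exact absurd (hω hnot) (not_le.2 hlt)

theorem theorem5
    {Ω : Type*} [MeasurableSpace Ω] (μ : Measure Ω) [IsProbabilityMeasure μ]
    -- number of covariates `p n`, rows per tail `r n`, subdata size `k n = 2 * p n * r n`
    (p r : ℕ → ℕ) (hp : ∀ n, 1 ≤ p n)
    (hr : ∀ᶠ n in atTop, 1 ≤ r n ∧ 2 * p n * r n ≤ n)
    -- the covariates of the full data of size `n`: independent rows, `j`-th marginal law `ν j`
    (Z : ∀ n, Ω → Fin n → Fin (p n) → ℝ) (hZ : ∀ n, Measurable (Z n))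
    (hindep : ∀ n, iIndepFun (fun (i : Fin n) (ω : Ω) => Z n ω i) μ)
    (ν : ℕ → Measure ℝ)
    (hν : ∀ n (i : Fin n) (j : Fin (p n)), μ.map (fun ω => Z n ω i j) = ν j)
    (hDA : ∀ n (j : Fin (p n)), InGEVDomain (ν j))
    -- the linear model: given the covariates, the errors are centred, uncorrelated, variance `σ²`
    (σ : ℝ) (hσ : 0 < σ)
    (β : ∀ n, Fin (p n + 1) → ℝ) (ε Y : ∀ n, Ω → Fin n → ℝ)
    (hY : ∀ n ω i, Y n ω i = β n 0 + (∑ j : Fin (p n), Z n ω i j * β n j.succ) + ε n ω i)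
    (hε2 : ∀ n i, MemLp (fun ω => ε n ω i) 2 μ)
    (hε_mean : ∀ n i,
      μ[fun ω => ε n ω i | MeasurableSpace.comap (Z n) inferInstance] =ᵐ[μ] fun _ => 0)
    (hε_cov : ∀ n i l,
      μ[fun ω => ε n ω i * ε n ω l | MeasurableSpace.comap (Z n) inferInstance]
        =ᵐ[μ] fun _ => if i = l then σ ^ 2 else 0)
    -- the rows selected by the algorithm, as a measurable function of the covariates
    (sel : ∀ n, (Fin n → Fin (p n) → ℝ) → Finset (Fin n))
    (hsel_meas : ∀ n (S : Finset (Fin n)), MeasurableSet {z | sel n z = S})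
    (hsel : ∀ n, 2 * p n * r n ≤ n → ∀ z, IsIBOSSSubset (r n) z (sel n z))
    -- `liminf λ_min(R) > 0` almost surely, `R` the sample correlation matrix of the subdata
    (hR : ∀ᵐ ω ∂μ, (0 : EReal) < liminf (fun n =>
      ((lambdaMin (sampleCorr (restrictRows (sel n (Z n ω)) (Z n ω))) : ℝ) : EReal)) atTop) :
    (∀ j : (∀ n, Fin (p n)),
      IsBigOP μ
        (fun n => condVarGiven μ
          (fun ω => subdataEstimator (sel n (Z n ω)) (Z n ω) (Y n ω) (j n).succ) (Z n))
        (fun n ω => rateOf (p n) (r n)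
          (orderStat (fun i => Z n ω i (j n)) (n - r n + 1)
            - orderStat (fun i => Z n ω i (j n)) (r n)))) ∧
    ((∃ P : ℕ, ∀ n, p n ≤ P) →
      ∀ (j : ℕ) (hj : ∀ n, j < p n), RangeCondition (ν j) r →
        IsSameOrderP μ
          (fun n => condVarGiven μ
            (fun ω => subdataEstimator (sel n (Z n ω)) (Z n ω) (Y n ω)
              (Fin.succ ⟨j, hj n⟩)) (Z n))
          (fun n ω => rateOf (p n) (r n)
            (orderStat (fun i => Z n ω i ⟨j, hj n⟩) n
              - orderStat (fun i => Z n ω i ⟨j, hj n⟩) 1))) := by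
  have hIID : ∀ (j : ℕ) (hj : ∀ n, j < p n),
      IsIIDArray μ (ν j) fun n i ω => Z n ω i ⟨j, hj n⟩ := fun j hj =>
    { measurable := fun n i =>
        (measurable_pi_apply _).comp ((measurable_pi_apply i).comp (hZ n))
      indep := fun n => (hindep n).comp (fun _ x => x ⟨j, hj n⟩) fun _ => measurable_pi_apply _
      law := fun n i => hν n i ⟨j, hj n⟩ }
  set G : ∀ n, Ω → Matrix (Fin (p n + 1)) (Fin (p n + 1)) ℝ := fun n ω =>
    gramMatrix (restrictRows (sel n (Z n ω)) (Z n ω)) with hG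
  have hvar : ∀ n q, ∀ᵐ ω ∂μ,
      condVarGiven μ (fun ω => subdataEstimator (sel n (Z n ω)) (Z n ω) (Y n ω) q) (Z n) ω
        = ENNReal.ofReal (σ ^ 2 * (G n ω)⁻¹ q q) := fun n q =>
    condVarGiven_subdataEstimator (hZ n) (hY n) (hε2 n) (hε_mean n) (hε_cov n) (hsel_meas n) q
  have hgood : ∀ δ : ℝ, 0 < δ → ∃ c : ℝ, 0 < c ∧ ∀ᶠ n in atTop,
      μ {ω | ¬ CorrBoundedBelow c (restrictRows (sel n (Z n ω)) (Z n ω))} ≤ ENNReal.ofReal δ := by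
    intro δ hδ
    refine exists_uniform_bound
      (P := fun n c ω => CorrBoundedBelow c (restrictRows (sel n (Z n ω)) (Z n ω)))
      (fun n c => hZ n (measurableSet_corrBoundedBelow_sel (hsel_meas n) c))
      (fun n c c' ω hcc h => h.mono hcc) ?_ hδ
    filter_upwards [hR] with ω hω
    obtain ⟨c, hc0, hc⟩ := EReal.lt_iff_exists_real_btwn.1 hω
    refine ⟨c, by exact_mod_cast hc0, ?_⟩
    filter_upwards [eventually_lt_of_lt_liminf hc] with n hn
    exact corrBoundedBelow_of_lt_lambdaMin (EReal.coe_lt_coe_iff.1 hn)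
  have hr2 : ∀ᶠ n in atTop, 1 ≤ r n ∧ 2 * r n ≤ n := by
    filter_upwards [hr] with n hn
    exact ⟨hn.1, le_trans (by nlinarith [hp n]) hn.2⟩
  refine ⟨fun j => isBigOP_of_forall_exists fun δ hδ => ?_, fun ⟨P, hP⟩ j hj hRC =>
    ⟨isBigOP_of_forall_exists fun δ hδ => ?_, isBigOP_of_forall_exists fun δ hδ => ?_⟩⟩
  · obtain ⟨c, hc, hev⟩ := hgood δ hδ
    refine ⟨8 * σ ^ 2 / c, by positivity, ?_⟩
    filter_upwards [hev, hr, hr2] with n hbad hrn hrn2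
    refine ⟨_, hbad, ?_⟩
    filter_upwards [hvar n (j n).succ] with ω hω hnot
    rw [hω]
    exact ofReal_var_le hc hσ (hsel n hrn.2 _) (not_not.1 hnot) (j n) hrn2.1 le_rfl hrn2.2
  · rcases hRC.cases with ⟨r₀, hr₀⟩ | ⟨hrn0, hup, hlow⟩
    · -- for constant `r` the two extreme rows alone give the rate, up to the factor `r`
      obtain ⟨c, hc, hev⟩ := hgood δ hδ
      refine ⟨8 * σ ^ 2 / c * (r₀ + 1), by positivity, ?_⟩
      filter_upwards [hev, hr, hr2, hr₀] with n hbad hrn hrn2 hrr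
      refine ⟨_, hbad, ?_⟩
      filter_upwards [hvar n (Fin.succ ⟨j, hj n⟩)] with ω hω hnot
      rw [hω]
      have h1 := ofReal_var_le hc hσ (hsel n hrn.2 _) (not_not.1 hnot) ⟨j, hj n⟩ le_rfl hrn2.1
        (by omega)
      rw [Nat.sub_add_cancel (by omega)] at h1
      refine h1.trans ?_
      rw [ENNReal.ofReal_mul (by positivity), mul_assoc]
      gcongr
      rw [← hrr]
      exact rateOf_one_le (hp n) hrn2.1 _
    · have hprob : IsProbabilityMeasure (ν j) := by
        rw [← hν 1 0 ⟨j, hj 1⟩]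
        exact Measure.isProbabilityMeasure_map ((hIID j hj).measurable 1 0).aemeasurable
      obtain ⟨M, hM, hlim⟩ := (hIID j hj).tendsto_range hr2 (hDA 0 ⟨j, hj 0⟩).1 hrn0 hup hlow
      obtain ⟨c, hc, hev⟩ := hgood (δ / 2) (half_pos hδ)
      refine ⟨8 * σ ^ 2 / c * M ^ 2, by positivity, ?_⟩
      filter_upwards [hev, hr, hr2,
        hlim.eventually_lt_const (ENNReal.ofReal_pos.2 (half_pos hδ))] with n hbad hrn hrn2 hbad'
      refine ⟨_ ∪ _, (measure_union_le _ _).trans ((add_le_add hbad hbad'.le).trans ?_), ?_⟩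
      · rw [← ENNReal.ofReal_add (half_pos hδ).le (half_pos hδ).le, add_halves]
      filter_upwards [hvar n (Fin.succ ⟨j, hj n⟩)] with ω hω hnot
      rw [Set.mem_union, not_or] at hnot
      rw [hω]
      refine (ofReal_var_le hc hσ (hsel n hrn.2 _) (not_not.1 hnot.1) ⟨j, hj n⟩ hrn2.1 le_rfl
        hrn2.2).trans ?_
      rw [ENNReal.ofReal_mul (by positivity), mul_assoc]
      gcongr
      refine rateOf_le_of_le_mul (hp n) hrn2.1 hM (sub_nonneg.2 ?_) (not_lt.1 hnot.2)
      exact orderStat_mono _ le_rfl (by omega) le_rfl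
  · obtain ⟨c, hc, hev⟩ := hgood δ hδ
    refine ⟨(P + 1) / σ ^ 2, by positivity, ?_⟩
    filter_upwards [hev, hr, hr2] with n hbad hrn hrn2
    refine ⟨_, hbad, ?_⟩
    filter_upwards [hvar n (Fin.succ ⟨j, hj n⟩)] with ω hω hnot
    rw [hω]
    refine (rateOf_range_le hc hσ hrn2.1 (hsel n hrn.2 _) (not_not.1 hnot) ⟨j, hj n⟩).trans ?_
    have : (p n : ℝ) ≤ P + 1 := by exact_mod_cast (hP n).trans (Nat.le_succ P)
    gcongr
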